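/- Let $\Gamma$ be a countably infinite discrete group which is not virtually cyclic, i.e. which has no cyclic subgroup of finite index. Let $\mathbb{Z}\Gamma$ be its integral group ring, write $f\in\mathbb{Z}\Gamma$ as $f=\sum_\gamma f_\gamma\cdot\gamma$, and put $f^*=\sum_\gamma f_\gamma\cdot\gamma^{-1}$. For $h\in\mathbb{Z}\Gamma$ let $\tilde\rho^{h}$ be the operator on $\ell^2(\Gamma,\mathbb{R})$ given by $(\tilde\rho^{h}v)_{\gamma'}=\sum_\gamma h_\gamma v_{\gamma'\gamma}$, so that $\tilde\rho^{f^*}v=v\cdot f$ is right multiplication (convolution) by $f$. Let $\mathbb{T}=\mathbb{R}/\mathbb{Z}$, let $$X_f=\Bigl\{x\in\mathbb{T}^\Gamma:\ \sum_{\gamma\in\Gamma} f_\gamma x_{\gamma'\gamma}=0\ \text{ for every }\gamma'\in\Gamma\Bigr\},$$ a compact abelian group, and let $\alpha_f$ be the principal algebraic $\Gamma$-action on $X_f$, that is, the restriction to $X_f$ of the left shift action $(\lambda^\gamma x)_{\gamma'}=x_{\gamma^{-1}\gamma'}$. If $$\ker\tilde\rho^{f^*}=\{v\in\ell^2(\Gamma,\mathbb{R}):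 v\cdot f=0\}=\{0\},$$ then $\alpha_f$ is ergodic with respect to the normalized Haar measure of $X_f$. -/

import Mathlib

open MeasureTheory

noncomputable section

namespace PrincipalAction

/-- A group is virtually cyclic if it has a cyclic subgroup of finite index. -/
def IsVirtuallyCyclic (Γ : Type*) [Group Γ] : Prop :=
  ∃ H : Subgroup Γ, IsCyclic H ∧ H.FiniteIndex

/-- The adjoint `f* = ∑ f_γ · γ⁻¹` of `f = ∑ f_γ · γ` in the integral group ring. -/
def adjoint {Γ : Type*} [Group Γ] (f : MonoidAlgebra ℤ Γ) : MonoidAlgebra ℤ Γ :=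
  f.mapDomain (fun γ => γ⁻¹)

theorem adjoint_coeff {Γ : Type*} [Group Γ] (f : MonoidAlgebra ℤ Γ) (γ : Γ) :
    (adjoint f).coeff γ = f.coeff γ⁻¹ := by
  have h := Finsupp.mapDomain_apply (M := ℤ) (inv_injective (G := Γ)) f.coeff γ⁻¹
  rw [inv_inv] at h
  exact h

/-! ### The shift actions on `𝕋 ^ Γ`, where `𝕋 = ℝ / ℤ` -/

/-- The left shift `(λ^γ x)_{γ'} = x_{γ⁻¹ γ'}` on `𝕋 ^ Γ`. -/
def leftShift {Γ : Type*} [Group Γ] (γ : Γ) : (Γ → UnitAddCircle) →+ (Γ → UnitAddCircle) where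
  toFun x := fun γ' => x (γ⁻¹ * γ')
  map_zero' := rfl
  map_add' _ _ := rfl

/-- The right shift `(ρ^γ x)_{γ'} = x_{γ' γ}` on `𝕋 ^ Γ`. -/
def rightShift {Γ : Type*} [Group Γ] (γ : Γ) : (Γ → UnitAddCircle) →+ (Γ → UnitAddCircle) where
  toFun x := fun γ' => x (γ' * γ)
  map_zero' := rfl
  map_add' _ _ := rfl

/-- The homomorphism `ρ^f = ∑ f_γ ρ^γ` of `𝕋 ^ Γ`, for `f` in the integral group ring. -/
def rho {Γ : Type*} [Group Γ] (f : MonoidAlgebra ℤ Γ) :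
    (Γ → UnitAddCircle) →+ (Γ → UnitAddCircle) :=
  f.coeff.sum fun γ n => n • rightShift γ

theorem rho_apply {Γ : Type*} [Group Γ] (f : MonoidAlgebra ℤ Γ) (x : Γ → UnitAddCircle)
    (γ' : Γ) : rho f x γ' = ∑ γ ∈ f.coeff.support, f.coeff γ • x (γ' * γ) := by
  simp [rho, Finsupp.sum, rightShift, AddMonoidHom.finsetSum_apply]

/-! ### The principal algebraic action -/

/-- The compact abelian group `X_f = ker ρ^f ⊆ 𝕋 ^ Γ`. -/
def X {Γ : Type*} [Group Γ] (f : MonoidAlgebra ℤ Γ) : AddSubgroup (Γ → UnitAddCircle) :=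
  (rho f).ker

theorem leftShift_mem {Γ : Type*} [Group Γ] (f : MonoidAlgebra ℤ Γ) (γ : Γ)
    {x : Γ → UnitAddCircle} (hx : x ∈ X f) : leftShift γ x ∈ X f := by
  rw [X, AddMonoidHom.mem_ker] at hx ⊢
  funext γ'
  have h := congrFun hx (γ⁻¹ * γ')
  rw [rho_apply] at h ⊢
  simpa [leftShift, mul_assoc] using h

/-- The principal algebraic action `α_f`: the restriction of the left shift action to `X_f`. -/
instance principalAction {Γ : Type*} [Group Γ] (f : MonoidAlgebra ℤ Γ) :
    DistribMulAction Γ (X f) where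
  smul γ x := ⟨leftShift γ x.1, leftShift_mem f γ x.2⟩
  one_smul x := Subtype.ext <| funext fun γ' => by
    change x.1 (1⁻¹ * γ') = x.1 γ'
    simp
  mul_smul γ δ x := Subtype.ext <| funext fun γ' => by
    change x.1 ((γ * δ)⁻¹ * γ') = x.1 (δ⁻¹ * (γ⁻¹ * γ'))
    simp [mul_assoc]
  smul_zero _ := rfl
  smul_add _ _ _ := rfl

theorem principalAction_apply {Γ : Type*} [Group Γ] (f : MonoidAlgebra ℤ Γ) (γ γ' : Γ) (x : X f) :
    (γ • x : X f).1 γ' = x.1 (γ⁻¹ * γ') := rfl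

instance principalAction_continuous {Γ : Type*} [Group Γ] (f : MonoidAlgebra ℤ Γ) :
    ContinuousConstSMul Γ (X f) where
  continuous_const_smul γ := by
    refine Continuous.subtype_mk (continuous_pi fun γ' => ?_) _
    exact (continuous_apply (γ⁻¹ * γ')).comp continuous_subtype_val

instance X_compactSpace {Γ : Type*} [Group Γ] (f : MonoidAlgebra ℤ Γ) : CompactSpace (X f) := by
  refine isCompact_iff_compactSpace.mp (IsClosed.isCompact ?_)
  have hX : (X f : Set (Γ → UnitAddCircle)) = {x | (fun γ' => rho f x γ') = 0} := by
    ext x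
    rfl
  rw [hX]
  refine isClosed_eq (continuous_pi fun γ' => ?_) continuous_const
  simp only [rho_apply]
  fun_prop

/-- The normalized Haar measure `μ_f` of the compact group `X_f`. -/
def haar {Γ : Type*} [Group Γ] [Countable Γ] (f : MonoidAlgebra ℤ Γ) : Measure (X f) :=
  Measure.addHaarMeasure ⊤

instance haar_isAddHaarMeasure {Γ : Type*} [Group Γ] [Countable Γ] (f : MonoidAlgebra ℤ Γ) :
    (haar f).IsAddHaarMeasure := by
  unfold haar
  infer_instance

instance haar_isProbabilityMeasure {Γ : Type*} [Group Γ] [Countable Γ] (f : MonoidAlgebra ℤ Γ) :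
    IsProbabilityMeasure (haar f) where
  measure_univ := by
    have h := Measure.addHaarMeasure_self (K₀ := (⊤ : TopologicalSpace.PositiveCompacts (X f)))
    simpa [haar] using h

/-! ### The right translations on `ℓ²(Γ, ℝ)` -/

theorem memlp_mul_right {Γ : Type*} [Group Γ] (γ : Γ) (v : lp (fun _ : Γ => ℝ) 2) :
    Memℓp (fun γ' => (v : Γ → ℝ) (γ' * γ)) 2 := by
  have hv := lp.memℓp v
  rw [memℓp_gen_iff (by norm_num)] at hv ⊢
  exact (Equiv.mulRight γ).summable_iff.mpr hv

/-- The right translation `(ρ̃^γ v)_{γ'} = v_{γ' γ}` on `ℓ²(Γ, ℝ)`. -/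
def rightTranslation {Γ : Type*} [Group Γ] (γ : Γ) :
    lp (fun _ : Γ => ℝ) 2 →ₗ[ℝ] lp (fun _ : Γ => ℝ) 2 where
  toFun v := ⟨fun γ' => (v : Γ → ℝ) (γ' * γ), memlp_mul_right γ v⟩
  map_add' _ _ := rfl
  map_smul' _ _ := rfl

/-- The operator `ρ̃^h = ∑ h_γ ρ̃^γ` on `ℓ²(Γ, ℝ)`, for `h` in the integral group ring. -/
def rhoTilde {Γ : Type*} [Group Γ] (h : MonoidAlgebra ℤ Γ) :
    lp (fun _ : Γ => ℝ) 2 →ₗ[ℝ] lp (fun _ : Γ => ℝ) 2 :=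
  h.coeff.sum fun γ n => (n : ℝ) • rightTranslation γ

theorem rhoTilde_apply {Γ : Type*} [Group Γ] (h : MonoidAlgebra ℤ Γ) (v : lp (fun _ : Γ => ℝ) 2)
    (γ' : Γ) : (rhoTilde h v : Γ → ℝ) γ' =
      ∑ γ ∈ h.coeff.support, (h.coeff γ : ℝ) * (v : Γ → ℝ) (γ' * γ) := by
  simp only [rhoTilde, Finsupp.sum, LinearMap.sum_apply, lp.coeFn_sum, Finset.sum_apply]
  rfl

end PrincipalAction

end

/-! The dual group of X_f is ℤΓ / ℤΓ f, so ergodicity reduces to a Fourier argument once every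
nontrivial character of X_f is known to have an infinite Γ-orbit (`infinite_orbit_character`). The
Fourier coefficients of an invariant set are constant along orbits, so by Bessel's inequality the
nontrivial ones vanish.

Suppose the class of a is fixed by a subgroup Δ of finite index, so that c_δ f = δ a - a for δ in Δ.
Injectivity of right multiplication by f makes c a cocycle, formally c_δ = δ v - v with v = a f⁻¹.
The task is to find v in ℤΓ (`exists_mul_eq_of_finiteIndex`). Injectivity on ℓ² also shows, by an
orthogonal decomposition, that finitely many of the c_δ are simultaneously ℓ²-limits of δ w - w with
w finitely supported (`exists_approx_coboundary`). On each right coset of Δ the cocycle integrates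
to an integer function b that changes only finitely often under each left translation. If b is
constant off a finite set on each coset, these limits at infinity determine v.

That constancy is the geometric core (`exists_finite_ne_of_energy`). If it fails, some level set A
of b is infinite with infinite complement. When Δ is finitely generated and not virtually cyclic,
every infinite almost invariant set contains two disjoint right translates of A or its complement
(`exists_disjoint_rightTranslates`). Iteration produces binary trees, which are transient: a
finitely supported function of small energy is small at the root (`exists_energy_bound`). Two values
of b would then differ by less than 1. -/

noncomputable section

namespace PrincipalAction

open scoped Pointwise

/-! ### Almost invariant sets -/

section AlmostInvariant

variable {G : Type*} [Group G]

/-- The right translate `A g` of a subset of a group. -/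
def rightTranslate (A : Set G) (g : G) : Set G := {x | x * g⁻¹ ∈ A}

/-- A subset of a group is almost invariant if it differs from each of its left translates by a
finite set. -/
def AlmostInvariant (A : Set G) : Prop := ∀ g : G, {x | ¬(g * x ∈ A ↔ x ∈ A)}.Finite

theorem mem_rightTranslate {A : Set G} {g x : G} : x ∈ rightTranslate A g ↔ x * g⁻¹ ∈ A := Iff.rfl

theorem rightTranslate_rightTranslate (A : Set G) (g h : G) :
    rightTranslate (rightTranslate A g) h = rightTranslate A (g * h) := by
  ext x
  simp [mem_rightTranslate, mul_assoc]

theorem finite_rightTranslate {A : Set G} (h : A.Finite) (g : G) :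
    (rightTranslate A g).Finite :=
  h.preimage (mul_left_injective g⁻¹).injOn

theorem AlmostInvariant.compl {A : Set G} (h : AlmostInvariant A) : AlmostInvariant Aᶜ := by
  intro g
  refine (h g).subset fun x hx => ?_
  simp only [Set.mem_compl_iff, Set.mem_ofPred_eq] at hx ⊢
  tauto

theorem AlmostInvariant.inter {A B : Set G} (hA : AlmostInvariant A) (hB : AlmostInvariant B) :
    AlmostInvariant (A ∩ B) := by
  intro g
  refine ((hA g).union (hB g)).subset fun x hx => ?_
  simp only [Set.mem_inter_iff, Set.mem_union, Set.mem_ofPred_eq] at hx ⊢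
  tauto

theorem AlmostInvariant.diff {A B : Set G} (hA : AlmostInvariant A) (hB : AlmostInvariant B) :
    AlmostInvariant (A \ B) := hA.inter hB.compl

theorem AlmostInvariant.rightTranslate {A : Set G} (hA : AlmostInvariant A) (g : G) :
    AlmostInvariant (rightTranslate A g) := by
  intro h
  refine (finite_rightTranslate (hA h) g).subset fun x hx => ?_
  simpa [mem_rightTranslate, mul_assoc] using hx

theorem almostInvariant_of_finite {A : Set G} (hA : A.Finite) : AlmostInvariant A := by
  intro g
  refine ((hA.preimage (mul_right_injective g).injOn).union hA).subset fun x hx => ?_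
  simp only [Set.mem_union, Set.mem_preimage, Set.mem_ofPred_eq] at hx ⊢
  tauto

/-- A finite set `K` is connected (relative to left multiplication by `S`) if a set whose
membership does not change along the edges starting in `K` contains all of `K` or none of it. -/
theorem exists_connected (S : Set G) (hS : Subgroup.closure S = ⊤) {F : Set G} (hF : F.Finite) :
    ∃ K : Set G, K.Finite ∧ F ⊆ K ∧
      ∀ E : Set G, (∀ x ∈ K, ∀ s ∈ S, s * x ∈ E ↔ x ∈ E) → ∀ x ∈ K, x ∈ E ↔ 1 ∈ E := by
  induction F, hF using Set.Finite.induction_on with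
  | empty => exact ⟨∅, Set.finite_empty, subset_rfl, fun _ _ x hx => hx.elim⟩
  | @insert a F _ _ ih =>
    obtain ⟨K, hK, hFK, hconn⟩ := ih
    suffices h : ∃ K : Set G, K.Finite ∧ a ∈ K ∧
        ∀ E : Set G, (∀ x ∈ K, ∀ s ∈ S, s * x ∈ E ↔ x ∈ E) → ∀ x ∈ K, x ∈ E ↔ 1 ∈ E by
      obtain ⟨K', hK', haK', hconn'⟩ := h
      refine ⟨K ∪ K', hK.union hK', Set.insert_subset (Or.inr haK')
        (hFK.trans Set.subset_union_left), fun E hE x hx => ?_⟩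
      rcases hx with hx | hx
      · exact hconn E (fun y hy => hE y (Or.inl hy)) x hx
      · exact hconn' E (fun y hy => hE y (Or.inr hy)) x hx
    clear * - hS
    have ha : a ∈ Subgroup.closure S := hS ▸ Subgroup.mem_top a
    induction ha using Subgroup.closure_induction_left with
    | one =>
      exact ⟨{1}, Set.finite_singleton 1, rfl, fun E _ x hx => by rw [Set.mem_singleton_iff.1 hx]⟩
    | mul_left s hs y _ ih =>
      obtain ⟨K', hK', hy, hc⟩ := ih
      refine ⟨insert (s * y) K', hK'.insert _, Set.mem_insert _ _, fun E hE x hx => ?_⟩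
      have hc' := hc E fun z hz => hE z (Set.mem_insert_of_mem _ hz)
      rcases hx with rfl | hx
      · rw [hE y (Set.mem_insert_of_mem _ hy) s hs, hc' y hy]
      · exact hc' x hx
    | inv_mul_cancel s hs y _ ih =>
      obtain ⟨K', hK', hy, hc⟩ := ih
      refine ⟨insert (s⁻¹ * y) K', hK'.insert _, Set.mem_insert _ _, fun E hE x hx => ?_⟩
      have hc' := hc E fun z hz => hE z (Set.mem_insert_of_mem _ hz)
      rcases hx with rfl | hx
      · rw [← hE (s⁻¹ * y) (Set.mem_insert _ _) s hs, mul_inv_cancel_left, hc' y hy]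
      · exact hc' x hx

/-- The Cayley graph of a generating set is connected, so a set without edge boundary is empty or
everything. -/
theorem mem_iff_of_invariant {S : Set G} (hS : Subgroup.closure S = ⊤) {E : Set G}
    (hE : ∀ x, ∀ s ∈ S, s * x ∈ E ↔ x ∈ E) (x y : G) : x ∈ E ↔ y ∈ E := by
  obtain ⟨K, -, hFK, hc⟩ := exists_connected S hS (Set.toFinite {x, y})
  have hc' := hc E fun z _ => hE z
  rw [hc' x (hFK (by simp)), hc' y (hFK (by simp))]

/-- Right translates of an almost invariant set `A` by elements of `B` are nested with `B`, with
finitely many exceptions. -/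
theorem exists_finite_nested {S : Set G} (hfin : S.Finite) (hS : Subgroup.closure S = ⊤)
    {A B : Set G} (hA : AlmostInvariant A) (hB : AlmostInvariant B) :
    ∃ F : Set G, F.Finite ∧ ∀ g ∈ B, g ∉ F →
      rightTranslate A g ⊆ B ∨ rightTranslate Aᶜ g ⊆ B := by
  set bA : Set G := ⋃ s ∈ S, {x | ¬(s * x ∈ A ↔ x ∈ A)} with hbA
  set bB : Set G := ⋃ s ∈ S, {x | ¬(s * x ∈ B ↔ x ∈ B)} with hbB
  have hbA_fin : bA.Finite := hfin.biUnion fun s _ => hA s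
  have hbB_fin : bB.Finite := hfin.biUnion fun s _ => hB s
  have memA : ∀ x ∉ bA, ∀ s ∈ S, s * x ∈ A ↔ x ∈ A := by
    intro x hx s hs
    by_contra h
    exact hx (Set.mem_biUnion hs h)
  have memB : ∀ x ∉ bB, ∀ s ∈ S, s * x ∈ B ↔ x ∈ B := by
    intro x hx s hs
    by_contra h
    exact hx (Set.mem_biUnion hs h)
  -- K is finite, connected and contains both boundaries. For g in B outside the exceptional set, K
  -- g misses the boundary of B and so lies in B, while K g⁻¹ misses that of A and so lies in A or
  -- in Aᶜ.
  obtain ⟨K, hK, hFK, hc⟩ := exists_connected S hS (hbA_fin.union hbB_fin)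
  have hAK : bA ⊆ K := Set.subset_union_left.trans hFK
  have hBK : bB ⊆ K := Set.subset_union_right.trans hFK
  refine ⟨K⁻¹ * bB ∪ bA⁻¹ * K, (hK.inv.mul hbB_fin).union (hbA_fin.inv.mul hK), ?_⟩
  intro g hgB hgF
  have h1 : ∀ x ∈ K, x * g ∉ bB := fun x hx h =>
    hgF (Or.inl ⟨x⁻¹, Set.inv_mem_inv.2 hx, x * g, h, by simp⟩)
  have h2 : ∀ x ∈ K, x * g⁻¹ ∉ bA := fun x hx h =>
    hgF (Or.inr ⟨(x * g⁻¹)⁻¹, Set.inv_mem_inv.2 h, x, hx, by simp⟩)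
  have hKB : ∀ x ∈ K, x * g ∈ B := by
    intro x hx
    refine (hc {x | x * g ∈ B} (fun y hy s hs => ?_) x hx).2 (by simpa using hgB)
    simpa [mul_assoc] using memB _ (h1 y hy) s hs
  have hKA : ∀ x ∈ K, x * g⁻¹ ∈ A ↔ g⁻¹ ∈ A := by
    intro x hx
    refine (hc {x | x * g⁻¹ ∈ A} (fun y hy s hs => ?_) x hx).trans (by simp)
    simpa [mul_assoc] using memA _ (h2 y hy) s hs
  suffices key : ∀ D : Set G, (∀ x ∉ bA, ∀ s ∈ S, s * x ∈ D ↔ x ∈ D) →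
      (∀ x ∈ K, x * g⁻¹ ∉ D) → rightTranslate D g ⊆ B by
    by_cases h : g⁻¹ ∈ A
    · exact Or.inr (key Aᶜ (fun x hx s hs => not_congr (memA x hx s hs))
        fun x hx => not_not.2 ((hKA x hx).2 h))
    · exact Or.inl (key A memA fun x hx => fun h' => h ((hKA x hx).1 h'))
  intro D hD hKD x hxD
  by_contra hxB
  -- D g \ B has no edge boundary: that of D g lies in K g, inside B and off the boundary of B, and
  -- that of B lies in K, which is disjoint from D g.
  have hinv := mem_iff_of_invariant hS (E := {x | x * g⁻¹ ∈ D ∧ x ∉ B}) ?_ x g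
  · exact (hinv.1 ⟨hxD, hxB⟩).2 hgB
  intro y s hs
  simp only [Set.mem_ofPred_eq]
  by_cases hyA : y * g⁻¹ ∈ bA
  · have hyB : y ∈ B := by simpa using hKB _ (hAK hyA)
    have hyb : y ∉ bB := by simpa using h1 _ (hAK hyA)
    have := memB y hyb s hs
    tauto
  · have hyD : s * y * g⁻¹ ∈ D ↔ y * g⁻¹ ∈ D := by simpa [mul_assoc] using hD _ hyA s hs
    by_cases hyB : y ∈ bB
    · have := hKD y (hBK hyB)
      tauto
    · have := memB y hyB s hs
      tauto

/-- A group with an almost invariant set `D` and an element `h` such that `D h` is a proper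
subset of `D` with finite complement is virtually cyclic. -/
theorem isVirtuallyCyclic_of_rightTranslate_subset {D : Set G} (hD : AlmostInvariant D) {h : G}
    (hsub : rightTranslate D h ⊆ D) (hne : rightTranslate D h ≠ D)
    (hfin : (D \ rightTranslate D h).Finite) (hDne : D.Nonempty) : IsVirtuallyCyclic G := by
  have hstep : ∀ x, x * h⁻¹ ∈ D → x ∈ D := fun x hx => hsub hx
  have hdown : ∀ (n : ℕ) x, x * (h ^ n)⁻¹ ∈ D → x ∈ D := by
    intro n
    induction n with
    | zero => intro x hx; simpa using hx
    | succ n ih =>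
      intro x hx
      refine hstep x (ih _ ?_)
      simpa [pow_succ, mul_assoc] using hx
  obtain ⟨e, heD, heh⟩ : ∃ e ∈ D, e * h⁻¹ ∉ D := by
    by_contra! hcon
    exact hne (hsub.antisymm hcon)
  have hord : Function.Injective fun n : ℕ => h ^ n := by
    rw [injective_pow_iff_not_isOfFinOrder, isOfFinOrder_iff_pow_eq_one]
    rintro ⟨n, hn, hpow⟩
    obtain ⟨m, rfl⟩ := Nat.exists_eq_succ_of_ne_zero hn.ne'
    refine heh (hdown m _ ?_)
    have : e * h⁻¹ * (h ^ m)⁻¹ = e := by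
      rw [mul_assoc, ← mul_inv_rev, ← pow_succ, hpow]; simp
    rwa [this]
  -- Each coset of ⟨h⟩ crosses the border of D at a point of D \ D h, so this finite set represents
  -- all cosets.
  have hcover : ∀ x, ∃ z : ℤ, x * h ^ z ∈ D \ rightTranslate D h := by
    intro x
    by_cases hx : x ∈ D
    · obtain ⟨o, ho⟩ : ∃ o, o ∉ D := ⟨_, heh⟩
      have hex : ∃ n : ℕ, x * (h ^ n)⁻¹ ∉ D := by
        by_contra! hcon
        -- Left multiplication by o x⁻¹ carries the points x h⁻ⁿ of D to o h⁻ⁿ, never in D since o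
        -- is not. Almost invariance allows only finitely many such points.
        refine Set.infinite_range_of_injective (f := fun n : ℕ => x * (h ^ n)⁻¹) ?_
          ((hD (o * x⁻¹)).subset ?_)
        · exact fun m n hmn => hord (inv_injective (mul_right_injective x hmn))
        · rintro _ ⟨n, rfl⟩ hiff
          refine ho (hdown n o ?_)
          simpa [mul_assoc] using hiff.2 (hcon n)
      classical
      obtain ⟨n, hn⟩ : ∃ n, Nat.find hex = n + 1 :=
        Nat.exists_eq_succ_of_ne_zero fun h0 => by
          have := Nat.find_spec hex
          rw [h0] at this
          exact this (by simpa using hx)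
      refine ⟨-(n : ℤ), ?_, ?_⟩
      · have := Nat.find_min hex (m := n) (by omega)
        simpa using this
      · have := Nat.find_spec hex
        rw [hn] at this
        simpa [mem_rightTranslate, pow_succ', mul_assoc] using this
    · have hex : ∃ n : ℕ, x * h ^ n ∈ D := by
        by_contra! hcon
        obtain ⟨o, ho⟩ := hDne
        refine Set.infinite_range_of_injective (f := fun n : ℕ => x * h ^ n) ?_
          ((hD (o * x⁻¹)).subset ?_)
        · exact fun m n hmn => hord (mul_right_injective x hmn)
        · rintro _ ⟨n, rfl⟩ hiff
          refine hcon n (hiff.1 ?_)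
          refine hdown n _ ?_
          simpa [mul_assoc] using ho
      classical
      obtain ⟨n, hn⟩ : ∃ n, Nat.find hex = n + 1 :=
        Nat.exists_eq_succ_of_ne_zero fun h0 => by
          have := Nat.find_spec hex
          rw [h0] at this
          exact hx (by simpa using this)
      refine ⟨((n + 1 : ℕ) : ℤ), ?_, ?_⟩
      · have := Nat.find_spec hex
        rw [hn] at this
        rwa [zpow_natCast]
      · have := Nat.find_min hex (m := n) (by omega)
        simpa [mem_rightTranslate, zpow_add_one, mul_assoc] using this
  refine ⟨Subgroup.zpowers h, inferInstance, ?_⟩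
  have : Finite (G ⧸ Subgroup.zpowers h) := by
    have : Finite ↥(D \ rightTranslate D h) := hfin
    refine Finite.of_surjective
      (fun y : ↥(D \ rightTranslate D h) => (QuotientGroup.mk y.1 : G ⧸ Subgroup.zpowers h)) ?_
    intro q
    obtain ⟨x, rfl⟩ := QuotientGroup.mk_surjective q
    obtain ⟨z, hz⟩ := hcover x
    refine ⟨⟨_, hz⟩, QuotientGroup.eq.2 ?_⟩
    refine Subgroup.mem_zpowers_iff.2 ⟨-z, ?_⟩
    simp
  exact Subgroup.finiteIndex_of_finite_quotient

/-- If infinitely many right translates of `D` agree with `D` up to finite sets, the group is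
virtually cyclic. -/
theorem isVirtuallyCyclic_of_infinite {S : Set G} (hfin : S.Finite)
    (hS : Subgroup.closure S = ⊤) {D : Set G} (hD : AlmostInvariant D) (hDinf : D.Infinite)
    (hDcinf : Dᶜ.Infinite)
    (hinf : {h : G | (D \ rightTranslate D h).Finite ∧ (rightTranslate D h \ D).Finite}.Infinite) :
    IsVirtuallyCyclic G := by
  obtain ⟨F₁, hF₁, hn₁⟩ := exists_finite_nested hfin hS hD hD
  obtain ⟨F₂, hF₂, hn₂⟩ := exists_finite_nested hfin hS hD hD.compl
  -- For a in D and b outside, D h = D puts a h⁻¹ in D and b h⁻¹ outside, so left multiplication by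
  -- b a⁻¹ changes membership at a h⁻¹.
  have hstab : {h : G | rightTranslate D h = D}.Finite := by
    obtain ⟨a, ha⟩ := hDinf.nonempty
    obtain ⟨b, hb⟩ := hDcinf.nonempty
    refine ((hD (b * a⁻¹)).preimage (f := fun h : G => a * h⁻¹)
      (fun x _ y _ hxy => inv_injective (mul_right_injective a hxy))).subset ?_
    intro h hh hiff
    have h1 : a * h⁻¹ ∈ D := by rw [← mem_rightTranslate, hh]; exact ha
    have h2 : b * h⁻¹ ∉ D := by rw [← mem_rightTranslate, hh]; exact hb
    exact h2 (by simpa [mul_assoc] using hiff.2 h1)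
  obtain ⟨h, ⟨hh1, hh2⟩, hh3⟩ := (hinf.sdiff ((hF₁.union hF₂).union hstab)).nonempty
  simp only [Set.mem_union, not_or, Set.mem_ofPred_eq] at hh3
  obtain ⟨⟨hhF₁, hhF₂⟩, hne⟩ := hh3
  by_cases hhD : h ∈ D
  · rcases hn₁ h hhD hhF₁ with hsub | hsub
    · exact isVirtuallyCyclic_of_rightTranslate_subset hD hsub hne hh1 hDinf.nonempty
    · refine absurd ((finite_rightTranslate hh1 h⁻¹).subset ?_) hDcinf
      intro x hx
      have hx' : x * h ∈ rightTranslate Dᶜ h := by simpa [mem_rightTranslate] using hx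
      rw [mem_rightTranslate, inv_inv]
      exact ⟨hsub hx', hx'⟩
  · rcases hn₂ h hhD hhF₂ with hsub | hsub
    · refine absurd (hh1.subset ?_) hDinf
      exact fun x hx => ⟨hx, fun hx' => hsub hx' hx⟩
    · have hsub' : D ⊆ rightTranslate D h := by
        intro x hx
        by_contra hx'
        exact hsub hx' hx
      have hinvs : ∀ x, x ∈ rightTranslate D h⁻¹ ↔ x * h ∈ D := by simp [mem_rightTranslate]
      refine isVirtuallyCyclic_of_rightTranslate_subset hD (h := h⁻¹) ?_ ?_ ?_ hDinf.nonempty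
      · intro x hx
        simpa [mem_rightTranslate] using hsub' ((hinvs x).1 hx)
      · intro heq
        refine hne (Set.ext fun x => ?_)
        have := Set.ext_iff.1 heq (x * h⁻¹)
        rw [hinvs] at this
        simpa [mem_rightTranslate] using this.symm
      · refine (finite_rightTranslate hh2 h⁻¹).subset ?_
        rintro x ⟨hx, hx'⟩
        rw [hinvs] at hx'
        refine ⟨?_, ?_⟩
        · simpa [mem_rightTranslate] using hx
        · simpa using hx'

/-- In a finitely generated group which is not virtually cyclic, every infinite almost invariant
set contains two disjoint right translates of `A` or its complement. -/
theorem exists_disjoint_rightTranslates {S : Set G} (hfin : S.Finite)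
    (hS : Subgroup.closure S = ⊤) (hG : ¬IsVirtuallyCyclic G) {A : Set G}
    (hA : AlmostInvariant A) (hAinf : A.Infinite) (hAcinf : Aᶜ.Infinite) {B : Set G}
    (hB : AlmostInvariant B) (hBinf : B.Infinite) :
    ∃ g₁ g₂, ∃ D₁ D₂ : Set G, (D₁ = A ∨ D₁ = Aᶜ) ∧ (D₂ = A ∨ D₂ = Aᶜ) ∧
      rightTranslate D₁ g₁ ⊆ B ∧ rightTranslate D₂ g₂ ⊆ B ∧
      Disjoint (rightTranslate D₁ g₁) (rightTranslate D₂ g₂) := by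
  by_contra! hcon
  have hAI : ∀ D : Set G, (D = A ∨ D = Aᶜ) → AlmostInvariant D := by
    rintro D (rfl | rfl)
    exacts [hA, hA.compl]
  -- If B \ D g were infinite, nesting applied to this almost invariant set would give a second
  -- translate in B disjoint from D g.
  have hco : ∀ D : Set G, (D = A ∨ D = Aᶜ) → ∀ g, rightTranslate D g ⊆ B →
      (B \ rightTranslate D g).Finite := by
    intro D hD g hg
    by_contra hinf
    have hB' := hB.diff ((hAI D hD).rightTranslate g)
    obtain ⟨F, hF, hn⟩ := exists_finite_nested hfin hS hA hB'
    obtain ⟨g', hg', hg'F⟩ := (Set.Infinite.sdiff hinf hF).nonempty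
    obtain ⟨D', hD', hsub⟩ : ∃ D' : Set G, (D' = A ∨ D' = Aᶜ) ∧
        rightTranslate D' g' ⊆ B \ rightTranslate D g := by
      rcases hn g' hg' hg'F with h | h
      exacts [⟨A, Or.inl rfl, h⟩, ⟨Aᶜ, Or.inr rfl, h⟩]
    refine hcon g g' D D' hD hD' hg (hsub.trans Set.sdiff_subset) ?_
    exact Set.disjoint_left.2 fun x hx hx' => (hsub hx').2 hx
  obtain ⟨F, hF, hn⟩ := exists_finite_nested hfin hS hA hB
  obtain ⟨D, hD, hDG⟩ : ∃ D : Set G, (D = A ∨ D = Aᶜ) ∧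
      {g | rightTranslate D g ⊆ B}.Infinite := by
    by_contra! hnone
    refine (hBinf.sdiff hF) (((hnone A (Or.inl rfl)).union (hnone Aᶜ (Or.inr rfl))).subset ?_)
    rintro g ⟨hg, hgF⟩
    exact hn g hg hgF
  have hDinf : D.Infinite ∧ Dᶜ.Infinite := by
    rcases hD with rfl | rfl
    exacts [⟨hAinf, hAcinf⟩, ⟨hAcinf, by rwa [compl_compl]⟩]
  -- Infinitely many translates D g are cofinite in B, hence agree pairwise up to finite sets.
  -- Translating by g₁⁻¹ compares them with D itself.
  refine hG (isVirtuallyCyclic_of_infinite hfin hS (hAI D hD) hDinf.1 hDinf.2 ?_)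
  obtain ⟨g₁, hg₁⟩ := hDG.nonempty
  have hback : ∀ g, rightTranslate (rightTranslate D g) g₁⁻¹ = rightTranslate D (g * g₁⁻¹) :=
    fun g => rightTranslate_rightTranslate D g g₁⁻¹
  have hback₁ : rightTranslate (rightTranslate D g₁) g₁⁻¹ = D := by
    rw [hback, mul_inv_cancel]; ext x; simp [mem_rightTranslate]
  refine (hDG.image (f := fun g => g * g₁⁻¹) (mul_left_injective g₁⁻¹).injOn).mono ?_
  rintro _ ⟨g, hg, rfl⟩
  constructor
  · refine (finite_rightTranslate (hco D hD g hg) g₁⁻¹).subset ?_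
    rintro x ⟨hx, hx'⟩
    rw [← hback₁] at hx
    exact ⟨hg₁ hx, fun h => hx' (hback g ▸ h)⟩
  · refine (finite_rightTranslate (hco D hD g₁ hg₁) g₁⁻¹).subset ?_
    rintro x ⟨hx, hx'⟩
    rw [← hback g] at hx
    rw [← hback₁] at hx'
    exact ⟨hg hx, hx'⟩

end AlmostInvariant

/-! ### Energy bounds on branching families of sets -/

section Energy

variable {G : Type*} [Group G]

/-- Suppose that each set `R i`, with its marked point `p i` removed, contains two disjoint right
translates of members of the family. Then a function which vanishes on `R i x` off a finite set has
energy at least `v (p i x) ^ 2` on `R i x`. -/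
theorem exists_energy_bound {ι : Type*} [Finite ι] (R : ι → Set G) (p : ι → G)
    (hp : ∀ i, p i ∈ R i)
    (hbranch : ∀ i, ∃ g₁ g₂ j₁ j₂, rightTranslate (R j₁) g₁ ⊆ R i \ {p i} ∧
      rightTranslate (R j₂) g₂ ⊆ R i \ {p i} ∧
      Disjoint (rightTranslate (R j₁) g₁) (rightTranslate (R j₂) g₂)) :
    ∃ S : Finset G, ∀ (v : G → ℝ) (i : ι) (x : G),
      (Function.support v ∩ rightTranslate (R i) x).Finite →
      ∃ Z : Finset G, (Z : Set G) ⊆ rightTranslate (R i) x ∧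
        v (p i * x) ^ 2 ≤ ∑ z ∈ Z, ∑ s ∈ S, (v (s * z) - v z) ^ 2 := by
  classical
  choose g₁ g₂ j₁ j₂ h₁ h₂ hd using hbranch
  have : Fintype ι := Fintype.ofFinite ι
  -- These elements carry the root p i x of a binary tree to its two children.
  set S : Finset G := Finset.univ.image (fun i => p (j₁ i) * g₁ i * (p i)⁻¹) ∪
    Finset.univ.image (fun i => p (j₂ i) * g₂ i * (p i)⁻¹) with hSdef
  refine ⟨S, fun v => ?_⟩
  -- Induction on the number of support points in the piece: the child pieces omit the root, so the
  -- count drops unless v vanishes there.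
  suffices key : ∀ (n : ℕ) (i : ι) (x : G),
      (Function.support v ∩ rightTranslate (R i) x).Finite →
      (Function.support v ∩ rightTranslate (R i) x).ncard ≤ n →
      ∃ Z : Finset G, (Z : Set G) ⊆ rightTranslate (R i) x ∧
        v (p i * x) ^ 2 ≤ ∑ z ∈ Z, ∑ s ∈ S, (v (s * z) - v z) ^ 2 from
    fun i x hfin => key _ i x hfin le_rfl
  have hmem : ∀ i x, p i * x ∈ rightTranslate (R i) x := fun i x => by
    simpa [mem_rightTranslate] using hp i
  intro n
  induction n with
  | zero =>
    intro i x hfin hcard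
    refine ⟨∅, by simp, ?_⟩
    have hempty := (Set.ncard_eq_zero hfin).1 (Nat.le_zero.1 hcard)
    have : v (p i * x) = 0 := by
      by_contra hne
      exact (Set.eq_empty_iff_forall_notMem.1 hempty) _ ⟨hne, hmem i x⟩
    simp [this]
  | succ n ih =>
    intro i x hfin hcard
    by_cases hv : v (p i * x) = 0
    · exact ⟨∅, by simp, by simp [hv]⟩
    have hsub : ∀ j g, rightTranslate (R j) g ⊆ R i \ {p i} →
        rightTranslate (R j) (g * x) ⊆ rightTranslate (R i) x \ {p i * x} := by
      intro j g h y hy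
      rw [← rightTranslate_rightTranslate] at hy
      have hy' := h hy
      refine ⟨hy'.1, fun hyp => hy'.2 ?_⟩
      rw [Set.mem_singleton_iff.1 hyp]
      simp
    have hrec : ∀ j g, rightTranslate (R j) g ⊆ R i \ {p i} →
        ∃ Z : Finset G, (Z : Set G) ⊆ rightTranslate (R j) (g * x) ∧
        v (p j * (g * x)) ^ 2 ≤ ∑ z ∈ Z, ∑ s ∈ S, (v (s * z) - v z) ^ 2 := by
      intro j g h
      have hs := hsub j g h
      have hss : Function.support v ∩ rightTranslate (R j) (g * x) ⊂
          Function.support v ∩ rightTranslate (R i) x := by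
        refine (Set.ssubset_iff_of_subset ?_).2 ⟨p i * x, ⟨hv, hmem i x⟩, fun h' => ?_⟩
        · exact Set.inter_subset_inter_right _ (hs.trans Set.sdiff_subset)
        · exact (hs h'.2).2 rfl
      refine ih j (g * x) (hfin.subset hss.subset) ?_
      have := Set.ncard_lt_ncard hss hfin
      omega
    obtain ⟨Z₁, hZ₁, hE₁⟩ := hrec _ _ (h₁ i)
    obtain ⟨Z₂, hZ₂, hE₂⟩ := hrec _ _ (h₂ i)
    have hs₁ := hsub _ _ (h₁ i)
    have hs₂ := hsub _ _ (h₂ i)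
    have hdis : Disjoint (rightTranslate (R (j₁ i)) (g₁ i * x))
        (rightTranslate (R (j₂ i)) (g₂ i * x)) := by
      rw [← rightTranslate_rightTranslate, ← rightTranslate_rightTranslate]
      exact Set.disjoint_left.2 fun y hy hy' => Set.disjoint_left.1 (hd i) hy hy'
    have hZdis : Disjoint Z₁ Z₂ := by
      rw [← Finset.disjoint_coe]
      exact hdis.mono hZ₁ hZ₂
    have hnot : p i * x ∉ Z₁ ∪ Z₂ := by
      rw [Finset.mem_union]
      rintro (h | h)
      · exact (hs₁ (hZ₁ h)).2 rfl
      · exact (hs₂ (hZ₂ h)).2 rfl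
    refine ⟨insert (p i * x) (Z₁ ∪ Z₂), ?_, ?_⟩
    · intro z hz
      simp only [Finset.coe_insert, Finset.coe_union, Set.mem_insert_iff, Set.mem_union] at hz
      rcases hz with rfl | hz | hz
      · exact hmem i x
      · exact (hs₁ (hZ₁ hz)).1
      · exact (hs₂ (hZ₂ hz)).1
    · rw [Finset.sum_insert hnot, Finset.sum_union hZdis]
      -- The two edges at the root must be distinct for both to count in the sum over S.
      have hne : p (j₁ i) * g₁ i * (p i)⁻¹ ≠ p (j₂ i) * g₂ i * (p i)⁻¹ := by
        intro heq
        have heq' := mul_right_cancel heq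
        refine Set.disjoint_left.1 (hd i) (hmem (j₁ i) (g₁ i)) ?_
        rw [heq']
        exact hmem (j₂ i) (g₂ i)
      have hpair : ({p (j₁ i) * g₁ i * (p i)⁻¹, p (j₂ i) * g₂ i * (p i)⁻¹} : Finset G) ⊆ S := by
        intro s hs
        rw [Finset.mem_insert, Finset.mem_singleton] at hs
        rcases hs with rfl | rfl
        · exact Finset.mem_union_left _ (Finset.mem_image_of_mem _ (Finset.mem_univ i))
        · exact Finset.mem_union_right _ (Finset.mem_image_of_mem _ (Finset.mem_univ i))
      have hE₀ := Finset.sum_le_sum_of_subset_of_nonneg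
        (f := fun s => (v (s * (p i * x)) - v (p i * x)) ^ 2) hpair
        fun _ _ _ => sq_nonneg _
      rw [Finset.sum_pair hne] at hE₀
      simp only [mul_assoc, inv_mul_cancel_left] at hE₀ hE₁ hE₂ ⊢
      -- For root value r and child value t, 2(t² + (t - r)²) = r² + (2t - r)², so each child
      -- contributes at least r²/2.
      nlinarith [sq_nonneg (2 * v (p (j₁ i) * (g₁ i * x)) - v (p i * x)),
        sq_nonneg (2 * v (p (j₂ i) * (g₂ i * x)) - v (p i * x))]

/-- Along a path in the Cayley graph b changes only at finitely many edges, so its values are b 1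
and those at the ends of these edges. -/
theorem finite_range_of_almostInvariant {S : Set G} (hfin : S.Finite)
    (hS : Subgroup.closure S = ⊤) (b : G → ℤ) (hb : ∀ g, {x | b (g * x) ≠ b x}.Finite) :
    (Set.range b).Finite := by
  set bd : Set G := ⋃ s ∈ S, {x | b (s * x) ≠ b x} with hbd
  have hbdfin : bd.Finite := hfin.biUnion fun s _ => hb s
  set T : Set ℤ := b '' bd ∪ ⋃ s ∈ S, (fun x => b (s * x)) '' bd with hT
  have hTfin : T.Finite :=
    (hbdfin.image _).union (hfin.biUnion fun s _ => hbdfin.image _)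
  have hT' : (T ∪ {b 1}).Finite := hTfin.union (Set.finite_singleton _)
  refine hT'.subset ?_
  rintro _ ⟨x, rfl⟩
  refine (mem_iff_of_invariant hS (E := {x | b x ∈ T ∪ {b 1}}) ?_ x 1).2 (Or.inr rfl)
  intro y s hs
  by_cases hy : y ∈ bd
  · have h1 : b y ∈ T := Or.inl ⟨y, hy, rfl⟩
    have h2 : b (s * y) ∈ T := Or.inr (Set.mem_biUnion hs ⟨y, hy, rfl⟩)
    exact ⟨fun _ => Or.inl h1, fun _ => Or.inl h2⟩
  · have : b (s * y) = b y := by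
      by_contra h
      exact hy (Set.mem_biUnion hs h)
    simp [this]

/-- An almost invariant function on a finitely generated group which is not virtually cyclic, and
which is a limit in energy of finitely supported functions, is constant off a finite set. -/
theorem exists_finite_ne_of_energy {S : Set G} (hfin : S.Finite)
    (hS : Subgroup.closure S = ⊤) (hG : ¬IsVirtuallyCyclic G) (b : G → ℤ)
    (hb : ∀ g, {x | b (g * x) ≠ b x}.Finite)
    (happ : ∀ (T : Finset G) (η : ℝ), 0 < η → ∃ w : G → ℝ, (Function.support w).Finite ∧
      ∀ Z : Finset G,
        ∑ z ∈ Z, ∑ s ∈ T, ((b (s * z) - w (s * z)) - (b z - w z)) ^ 2 ≤ η) :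
    ∃ β : ℤ, {x | b x ≠ β}.Finite := by
  classical
  by_contra! hcon
  have hcon' : ∀ β, {x | b x ≠ β}.Infinite := hcon
  have hrange := finite_range_of_almostInvariant hfin hS b hb
  have hlevel : ∀ U : Set ℤ, (b ⁻¹' U).Infinite → ∃ β ∈ U, (b ⁻¹' {β}).Infinite := by
    intro U hU
    by_contra! hnone
    refine hU ?_
    have : b ⁻¹' U = b ⁻¹' (U ∩ Set.range b) := by ext; simp
    rw [this]
    exact (hrange.inter_of_right U).preimage' fun β hβ => hnone β hβ.1
  have hAI : ∀ β, AlmostInvariant (b ⁻¹' {β}) := by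
    intro β g
    refine (hb g).subset fun x hx h => hx ?_
    simp [h]
  obtain ⟨β, -, hβ⟩ := hlevel Set.univ ((hcon' 0).mono fun _ _ => trivial)
  obtain ⟨β', hne, hβ'⟩ := hlevel {β}ᶜ (hcon' β)
  set A := b ⁻¹' {β} with hA
  have hAcinf : Aᶜ.Infinite := hcon' β
  set R : Bool → Set G := fun i => cond i A Aᶜ with hR
  have hRinf : ∀ i, (R i).Infinite := by rintro (_ | _); exacts [hAcinf, hβ]
  have hRAI : ∀ i, AlmostInvariant (R i) := by
    rintro (_ | _); exacts [(hAI β).compl, hAI β]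
  have hRor : ∀ D : Set G, (D = A ∨ D = Aᶜ) → ∃ i, D = R i := by
    rintro D (rfl | rfl)
    exacts [⟨true, rfl⟩, ⟨false, rfl⟩]
  choose p hp using fun i => (hRinf i).nonempty
  obtain ⟨T, hT⟩ := exists_energy_bound R p hp fun i => by
    obtain ⟨g₁, g₂, D₁, D₂, hD₁, hD₂, h⟩ := exists_disjoint_rightTranslates hfin hS hG (hAI β) hβ
      hAcinf ((hRAI i).diff (almostInvariant_of_finite (Set.finite_singleton (p i))))
      ((hRinf i).sdiff (Set.finite_singleton (p i)))
    obtain ⟨j₁, rfl⟩ := hRor D₁ hD₁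
    obtain ⟨j₂, rfl⟩ := hRor D₂ hD₂
    exact ⟨g₁, g₂, j₁, j₂, h⟩
  obtain ⟨g, -, D, -, hD, -, hDsub, -, -⟩ := exists_disjoint_rightTranslates hfin hS hG (hAI β) hβ
    hAcinf (hAI β') hβ'
  obtain ⟨j, rfl⟩ := hRor D hD
  -- The added element joins the root of A to the root of a piece on which b = β'. Energy at most
  -- 1/16 bounds by 1/4 each of w at the two roots and the jump of b - w between them, so |β' - β| ≤
  -- 3/4.
  obtain ⟨w, hw, hE⟩ := happ (insert (p j * g * (p true)⁻¹) T) (1 / 16) (by norm_num)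
  have hbound : ∀ (i : Bool) (x : G) (c : ℤ), (∀ y ∈ rightTranslate (R i) x, b y = c) →
      w (p i * x) ^ 2 ≤ 1 / 16 := by
    intro i x c hc
    -- Where b = c this function equals -w, and subtracting c leaves the energy unchanged.
    have hsupp : (Function.support (fun y => (b y - w y) - c : G → ℝ) ∩
        rightTranslate (R i) x).Finite := by
      refine hw.subset ?_
      rintro y ⟨hy, hyR⟩ hwy
      refine hy ?_
      simp [hc y hyR, hwy]
    obtain ⟨Z, -, hZ⟩ := hT (fun y => (b y - w y) - c) i x hsupp
    have hpi : b (p i * x) = c := hc _ (by simpa [mem_rightTranslate] using hp i)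
    rw [hpi] at hZ
    calc w (p i * x) ^ 2 = ((c - w (p i * x)) - c : ℝ) ^ 2 := by ring
      _ ≤ _ := hZ
      _ ≤ _ := ?_
      _ ≤ 1 / 16 := hE Z
    simp only [sub_sub_sub_cancel_right]
    exact Finset.sum_le_sum fun z _ => Finset.sum_le_sum_of_subset_of_nonneg
      (Finset.subset_insert _ _) fun _ _ _ => sq_nonneg _
  have hbp : b (p true) = β := hp true
  have hmemq : p j * g ∈ rightTranslate (R j) g := by simpa [mem_rightTranslate] using hp j
  have hbq : b (p j * g) = β' := hDsub hmemq
  have h1 := hbound true 1 β fun y hy => by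
    have hyA : y ∈ R true := by simpa [mem_rightTranslate] using hy
    exact hyA
  have h2 := hbound j g β' fun y hy => hDsub hy
  have h3 := (Finset.single_le_sum (fun s _ => sq_nonneg _)
    (Finset.mem_insert_self (p j * g * (p true)⁻¹) T)).trans
      ((Finset.sum_singleton _ _).symm.le.trans (hE {p true}))
  rw [inv_mul_cancel_right, hbp, hbq] at h3
  rw [mul_one] at h1
  have e1 := abs_le_of_sq_le_sq' (by linarith : w (p true) ^ 2 ≤ (1 / 4) ^ 2) (by norm_num)
  have e2 := abs_le_of_sq_le_sq' (by linarith : w (p j * g) ^ 2 ≤ (1 / 4) ^ 2) (by norm_num)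
  have e3 := abs_le_of_sq_le_sq' (by linarith :
    ((β' - w (p j * g)) - (β - w (p true)) : ℝ) ^ 2 ≤ (1 / 4) ^ 2) (by norm_num)
  refine hne ?_
  have l1 : (β' : ℝ) < β + 1 := by linarith [e1.1, e1.2, e2.1, e2.2, e3.1, e3.2]
  have l2 : (β : ℝ) < β' + 1 := by linarith [e1.1, e1.2, e2.1, e2.2, e3.1, e3.2]
  have l1' : β' < β + 1 := by exact_mod_cast l1
  have l2' : β < β' + 1 := by exact_mod_cast l2
  exact (by omega : β' = β)

end Energy

/-! ### Convolution operators on `ℓ²(Γ, ℝ)` -/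

/-- If an injective operator `T` and its adjoint preserve a subspace `W` of a Hilbert space, then a
vector which `T` maps to `W` lies in the closure of `W`. -/
theorem mem_topologicalClosure_of_injective {E : Type*} [NormedAddCommGroup E]
    [InnerProductSpace ℝ E] [CompleteSpace E] (W : Submodule ℝ E) (T T' : E →ₗ[ℝ] E)
    (hT : Continuous T) (hadj : ∀ u v, inner ℝ (T u) v = inner ℝ u (T' v))
    (hW : ∀ w ∈ W, T w ∈ W) (hW' : ∀ w ∈ W, T' w ∈ W) (hinj : ∀ u, T u = 0 → u = 0)
    {c : E} (hc : T c ∈ W) : c ∈ W.topologicalClosure := by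
  have : CompleteSpace W.topologicalClosure :=
    W.isClosed_topologicalClosure.completeSpace_coe
  obtain ⟨y, hy, z, hz, rfl⟩ := W.topologicalClosure.exists_add_mem_mem_orthogonal c
  have hTy : T y ∈ W.topologicalClosure := by
    have hmap : Set.MapsTo T (closure (W : Set E)) (closure (W : Set E)) :=
      Set.MapsTo.closure (fun w hw => hW w hw) hT
    exact hmap hy
  have hTz : T z ∈ W.topologicalClosure := by
    have := W.topologicalClosure.sub_mem (W.le_topologicalClosure hc) hTy
    simpa using this
  -- Since T' preserves W, T preserves its orthogonal complement. Thus T z is orthogonal to itself.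
  have hTz' : T z ∈ W.topologicalClosureᗮ := by
    rw [Submodule.orthogonal_closure] at hz ⊢
    rw [Submodule.mem_orthogonal'] at hz ⊢
    intro w hw
    rw [hadj]
    exact hz _ (hW' w hw)
  have hz0 : T z = 0 := by
    rw [← inner_self_eq_zero (𝕜 := ℝ)]
    exact (Submodule.mem_orthogonal _ _).1 hTz' _ hTz
  rw [hinj z hz0, add_zero]
  exact hy

section FiniteSupport

variable {Γ : Type*}

/-- The finitely supported elements of `ℓ²(Γ, ℝ)`. -/
def finiteSupport (Γ : Type*) : Submodule ℝ (lp (fun _ : Γ => ℝ) 2) where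
  carrier := {v | (Function.support (v : Γ → ℝ)).Finite}
  zero_mem' := (Set.finite_empty).subset fun _ h => h rfl
  add_mem' hu hv := (hu.union hv).subset (Function.support_add _ _)
  smul_mem' c _ hv := hv.subset (Function.support_const_smul_subset c _)

/-- The inclusion of the integral group ring in `ℓ²(Γ, ℝ)`. -/
def toL2 (a : MonoidAlgebra ℤ Γ) : lp (fun _ : Γ => ℝ) 2 :=
  ⟨fun γ => a.coeff γ, by
    refine (memℓp_zero (a.coeff.hasFiniteSupport.subset fun γ hγ => ?_)).of_exponent_ge (by simp)
    simpa using hγ⟩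

theorem toL2_apply (a : MonoidAlgebra ℤ Γ) (γ : Γ) : (toL2 a : Γ → ℝ) γ = a.coeff γ := rfl

theorem toL2_mem_finiteSupport (a : MonoidAlgebra ℤ Γ) : toL2 a ∈ finiteSupport Γ :=
  a.coeff.hasFiniteSupport.subset fun γ hγ => by simpa [toL2_apply] using hγ

theorem toL2_injective : Function.Injective (toL2 : MonoidAlgebra ℤ Γ → _) := by
  intro a b hab
  ext γ
  have := congrArg (fun v : lp (fun _ : Γ => ℝ) 2 => (v : Γ → ℝ) γ) hab
  simpa [toL2_apply] using this

end FiniteSupport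

section Convolution

variable {Γ : Type*} [Group Γ]

theorem rightTranslation_apply (γ γ' : Γ) (v : lp (fun _ : Γ => ℝ) 2) :
    (rightTranslation γ v : Γ → ℝ) γ' = (v : Γ → ℝ) (γ' * γ) := rfl

theorem inner_rightTranslation (γ : Γ) (u v : lp (fun _ : Γ => ℝ) 2) :
    inner ℝ (rightTranslation γ u) v = inner ℝ u (rightTranslation γ⁻¹ v) := by
  rw [lp.inner_eq_tsum, lp.inner_eq_tsum,
    ← (Equiv.mulRight γ).tsum_eq fun i => inner ℝ ((u : Γ → ℝ) i) _]
  simp [rightTranslation_apply]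

theorem norm_rightTranslation (γ : Γ) (v : lp (fun _ : Γ => ℝ) 2) :
    ‖rightTranslation γ v‖ = ‖v‖ := by
  have h : rightTranslation γ⁻¹ (rightTranslation γ v) = v := by
    ext γ'
    simp [rightTranslation_apply]
  rw [← sq_eq_sq₀ (norm_nonneg _) (norm_nonneg _), ← real_inner_self_eq_norm_sq,
    ← real_inner_self_eq_norm_sq, inner_rightTranslation, h]

theorem continuous_rightTranslation (γ : Γ) :
    Continuous (rightTranslation γ : lp (fun _ : Γ => ℝ) 2 →ₗ[ℝ] lp (fun _ : Γ => ℝ) 2) :=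
  LinearIsometry.continuous ⟨rightTranslation γ, norm_rightTranslation γ⟩

theorem rhoTilde_eq_sum (h : MonoidAlgebra ℤ Γ) (v : lp (fun _ : Γ => ℝ) 2) :
    rhoTilde h v = ∑ γ ∈ h.coeff.support, (h.coeff γ : ℝ) • rightTranslation γ v := by
  simp [rhoTilde, Finsupp.sum]

theorem continuous_rhoTilde (h : MonoidAlgebra ℤ Γ) : Continuous (rhoTilde h) := by
  have : (rhoTilde h : lp (fun _ : Γ => ℝ) 2 → lp (fun _ : Γ => ℝ) 2) =
      fun v => ∑ γ ∈ h.coeff.support, (h.coeff γ : ℝ) • rightTranslation γ v :=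
    funext (rhoTilde_eq_sum h)
  rw [this]
  exact continuous_finsetSum _ fun γ _ => by
    have := continuous_rightTranslation γ
    fun_prop

theorem rhoTilde_adjoint_eq_sum (h : MonoidAlgebra ℤ Γ) (v : lp (fun _ : Γ => ℝ) 2) :
    rhoTilde (adjoint h) v =
      ∑ γ ∈ h.coeff.support, (h.coeff γ : ℝ) • rightTranslation γ⁻¹ v := by
  have h1 : rhoTilde (adjoint h) = (Finsupp.mapDomain (fun γ => γ⁻¹) h.coeff).sum
    fun γ n => (n : ℝ) • rightTranslation γ := rfl
  rw [h1, Finsupp.sum_mapDomain_index (by simp) (by simp [add_smul])]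
  simp [Finsupp.sum]

theorem inner_rhoTilde_adjoint (h : MonoidAlgebra ℤ Γ) (u v : lp (fun _ : Γ => ℝ) 2) :
    inner ℝ (rhoTilde (adjoint h) u) v = inner ℝ u (rhoTilde h v) := by
  rw [rhoTilde_adjoint_eq_sum, rhoTilde_eq_sum, sum_inner, inner_sum]
  refine Finset.sum_congr rfl fun γ _ => ?_
  rw [real_inner_smul_left, real_inner_smul_right, inner_rightTranslation, inv_inv]

theorem rhoTilde_adjoint_apply (h : MonoidAlgebra ℤ Γ) (v : lp (fun _ : Γ => ℝ) 2) (γ' : Γ) :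
    (rhoTilde (adjoint h) v : Γ → ℝ) γ' =
      ∑ γ ∈ h.coeff.support, (h.coeff γ : ℝ) * (v : Γ → ℝ) (γ' * γ⁻¹) := by
  rw [rhoTilde_adjoint_eq_sum, lp.coeFn_sum, Finset.sum_apply]
  rfl

theorem memlp_mul_left (γ : Γ) (v : lp (fun _ : Γ => ℝ) 2) :
    Memℓp (fun γ' => (v : Γ → ℝ) (γ⁻¹ * γ')) 2 := by
  have hv := lp.memℓp v
  rw [memℓp_gen_iff (by norm_num)] at hv ⊢
  exact (Equiv.mulLeft γ⁻¹).summable_iff.mpr hv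

/-- The left translation `v ↦ (γ' ↦ v (γ⁻¹ γ'))` on `ℓ²(Γ, ℝ)`. -/
def leftTranslation (γ : Γ) : lp (fun _ : Γ => ℝ) 2 →ₗ[ℝ] lp (fun _ : Γ => ℝ) 2 where
  toFun v := ⟨fun γ' => (v : Γ → ℝ) (γ⁻¹ * γ'), memlp_mul_left γ v⟩
  map_add' _ _ := rfl
  map_smul' _ _ := rfl

theorem leftTranslation_apply (γ γ' : Γ) (v : lp (fun _ : Γ => ℝ) 2) :
    (leftTranslation γ v : Γ → ℝ) γ' = (v : Γ → ℝ) (γ⁻¹ * γ') := rfl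

theorem rhoTilde_leftTranslation (h : MonoidAlgebra ℤ Γ) (γ : Γ) (v : lp (fun _ : Γ => ℝ) 2) :
    rhoTilde h (leftTranslation γ v) = leftTranslation γ (rhoTilde h v) := by
  ext γ'
  simp only [leftTranslation_apply, rhoTilde_apply, mul_assoc]

theorem rhoTilde_mem_finiteSupport (h : MonoidAlgebra ℤ Γ) {v : lp (fun _ : Γ => ℝ) 2}
    (hv : v ∈ finiteSupport Γ) : rhoTilde h v ∈ finiteSupport Γ := by
  rw [rhoTilde_eq_sum]
  refine Submodule.sum_mem _ fun γ _ => Submodule.smul_mem _ _ ?_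
  exact Set.Finite.preimage (mul_left_injective γ).injOn hv

theorem rhoTilde_adjoint_toL2 (a f : MonoidAlgebra ℤ Γ) :
    rhoTilde (adjoint f) (toL2 a) = toL2 (a * f) := by
  ext γ
  rw [rhoTilde_adjoint_apply, toL2_apply, MonoidAlgebra.coeff_mul_apply_right, Finsupp.sum]
  simp [toL2_apply, mul_comm]

theorem mul_right_cancel_of_ker {f : MonoidAlgebra ℤ Γ}
    (hf : LinearMap.ker (rhoTilde (adjoint f)) = ⊥) {a b : MonoidAlgebra ℤ Γ}
    (h : a * f = b * f) : a = b := by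
  refine toL2_injective (LinearMap.ker_eq_bot.1 hf ?_)
  rw [rhoTilde_adjoint_toL2, rhoTilde_adjoint_toL2, h]

theorem leftTranslation_toL2 (a : MonoidAlgebra ℤ Γ) (γ : Γ) :
    leftTranslation γ (toL2 a) = toL2 (MonoidAlgebra.single γ 1 * a) := by
  ext γ'
  rw [leftTranslation_apply, toL2_apply, toL2_apply, MonoidAlgebra.coeff_single_mul_apply, one_mul]

/-- A family `c` with `c s * f = s * a - a` is a limit of families `s * w - w`, with `w` finitely
supported, if right multiplication by `f` is injective on `ℓ²`. -/
theorem exists_approx_coboundary {f : MonoidAlgebra ℤ Γ}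
    (hf : LinearMap.ker (rhoTilde (adjoint f)) = ⊥) (a : MonoidAlgebra ℤ Γ)
    (c : Γ → MonoidAlgebra ℤ Γ) (T : Finset Γ)
    (hc : ∀ s ∈ T, c s * f = MonoidAlgebra.single s 1 * a - a) {η : ℝ} (hη : 0 < η) :
    ∃ w : Γ → ℝ, (Function.support w).Finite ∧ ∀ Z : Finset Γ,
      ∑ z ∈ Z, ∑ s ∈ T, ((c s).coeff z - (w (s⁻¹ * z) - w z)) ^ 2 ≤ η := by
  let E := PiLp 2 fun _ : T => lp (fun _ : Γ => ℝ) 2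
  let diag (h : MonoidAlgebra ℤ Γ) : E →ₗ[ℝ] E :=
    { toFun := fun u => WithLp.toLp 2 fun s => rhoTilde h (u s)
      map_add' := fun u v => by ext s : 1; exact map_add (rhoTilde h) (u s) (v s)
      map_smul' := fun r v => by ext s : 1; exact map_smul (rhoTilde h) r (v s) }
  have hdiag : ∀ h u s, (diag h u) s = rhoTilde h (u s) := fun _ _ _ => rfl
  let D : lp (fun _ : Γ => ℝ) 2 →ₗ[ℝ] E :=
    { toFun := fun w => WithLp.toLp 2 fun s => leftTranslation s.1 w - w
      map_add' := fun u v => by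
        ext s : 1
        exact map_add (leftTranslation s.1 - LinearMap.id) u v
      map_smul' := fun r v => by
        ext s : 1
        exact map_smul (leftTranslation s.1 - LinearMap.id) r v }
  have hD : ∀ w s, (D w) s = leftTranslation s.1 w - w := fun _ _ => rfl
  have hcomm : ∀ h w, diag h (D w) = D (rhoTilde h w) := by
    intro h w
    ext s : 1
    rw [hdiag, hD, hD, map_sub, rhoTilde_leftTranslation]
  set W : Submodule ℝ E := (finiteSupport Γ).map D with hW
  have hpres : ∀ h, ∀ w ∈ W, diag h w ∈ W := by
    rintro h _ ⟨w, hw, rfl⟩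
    exact ⟨rhoTilde h w, rhoTilde_mem_finiteSupport h hw, (hcomm h w).symm⟩
  let cE : E := WithLp.toLp 2 fun s => toL2 (c s.1)
  have hcE : cE ∈ W.topologicalClosure := by
    refine mem_topologicalClosure_of_injective W (diag (adjoint f)) (diag f) ?_ ?_
      (hpres _) (hpres _) ?_ ?_
    · refine (PiLp.continuous_toLp 2 _).comp (continuous_pi fun s => ?_)
      exact (continuous_rhoTilde _).comp (PiLp.continuous_apply 2 _ s)
    · intro u v
      rw [PiLp.inner_apply, PiLp.inner_apply]
      exact Finset.sum_congr rfl fun s _ => inner_rhoTilde_adjoint f _ _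
    · intro u hu
      ext s : 1
      refine LinearMap.ker_eq_bot'.1 hf _ ?_
      rw [← hdiag, hu]
      rfl
    -- Right multiplication by f turns the family c into the coboundary of a itself.
    · refine ⟨toL2 a, toL2_mem_finiteSupport a, ?_⟩
      ext s : 1
      rw [hD, hdiag, leftTranslation_toL2]
      change _ = rhoTilde (adjoint f) (toL2 (c s.1))
      rw [rhoTilde_adjoint_toL2, hc s.1 s.2]
      ext γ
      simp [toL2_apply]
  have hcE' : cE ∈ closure (W : Set E) := hcE
  obtain ⟨_, ⟨w, hw, rfl⟩, hdist⟩ := Metric.mem_closure_iff.1 hcE' (Real.sqrt η)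
    (Real.sqrt_pos.2 hη)
  refine ⟨w, hw, fun Z => ?_⟩
  rw [dist_eq_norm] at hdist
  have hsq : ‖cE - D w‖ ^ 2 ≤ η := by
    rw [← Real.sq_sqrt hη.le]
    exact pow_le_pow_left₀ (norm_nonneg _) hdist.le 2
  rw [PiLp.norm_sq_eq_of_L2] at hsq
  refine le_trans ?_ hsq
  rw [Finset.sum_comm, ← Finset.sum_coe_sort T]
  refine Finset.sum_le_sum fun s _ => ?_
  have := lp.sum_rpow_le_norm_rpow (p := 2) (by norm_num) ((cE - D w) s) Z
  simp only [ENNReal.toReal_ofNat, Real.rpow_ofNat, Real.norm_eq_abs, sq_abs] at this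
  exact this

end Convolution

/-! ### Finite orbits in `ℤΓ / ℤΓ f` -/

section FiniteOrbits

variable {Γ : Type*} [Group Γ]

theorem IsVirtuallyCyclic.of_finiteIndex {Δ : Subgroup Γ} [Δ.FiniteIndex]
    (h : IsVirtuallyCyclic Δ) : IsVirtuallyCyclic Γ := by
  obtain ⟨H, hcyc, hfin⟩ := h
  refine ⟨H.map Δ.subtype, ?_, ⟨?_⟩⟩
  · exact isCyclic_of_surjective (Δ.subtype.subgroupMap H) (Δ.subtype.subgroupMap_surjective H)
  · rw [Subgroup.index_map_subtype]
    exact mul_ne_zero hfin.index_ne_zero Subgroup.FiniteIndex.index_ne_zero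

/-- If `c f = g a - a` for an element `g` outside a subgroup which contains the supports of `a` and
`f`, then `a` is a left multiple of `f`. -/
theorem exists_mul_eq_of_notMem {a c f : MonoidAlgebra ℤ Γ} {H : Subgroup Γ}
    (ha : ∀ γ, a.coeff γ ≠ 0 → γ ∈ H) (hf : ∀ γ, f.coeff γ ≠ 0 → γ ∈ H) {g : Γ} (hg : g ∉ H)
    (h : c * f = MonoidAlgebra.single g 1 * a - a) : ∃ e : MonoidAlgebra ℤ Γ, e * f = a := by
  classical
  -- Right multiplication by f respects the left cosets of H, and g a lives on g H ≠ H. The part of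
  -- the equation on H reads c|_H f = -a.
  refine ⟨-MonoidAlgebra.ofCoeff (c.coeff.filter (· ∈ H)), ?_⟩
  ext x
  have hx := congrArg (fun u : MonoidAlgebra ℤ Γ => u.coeff x) h
  simp only [MonoidAlgebra.coeff_sub, Finsupp.sub_apply, MonoidAlgebra.coeff_single_mul_apply,
    one_mul] at hx
  rw [MonoidAlgebra.coeff_mul_apply_right, Finsupp.sum] at hx
  rw [neg_mul, MonoidAlgebra.coeff_neg, Finsupp.neg_apply, MonoidAlgebra.coeff_mul_apply_right,
    Finsupp.sum]
  by_cases hxH : x ∈ H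
  · have hgx : a.coeff (g⁻¹ * x) = 0 := by
      by_contra hne
      have := H.mul_mem hxH (H.inv_mem (ha _ hne))
      simp only [mul_inv_rev, inv_inv, mul_inv_cancel_left] at this
      exact hg this
    rw [hgx, zero_sub] at hx
    rw [← neg_neg (a.coeff x), ← hx]
    refine congrArg _ (Finset.sum_congr rfl fun y hy => ?_)
    rw [MonoidAlgebra.coeff_ofCoeff, Finsupp.filter_apply_pos]
    exact H.mul_mem hxH (H.inv_mem (hf y (Finsupp.mem_support_iff.1 hy)))
  · have hax : a.coeff x = 0 := by
      by_contra hne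
      exact hxH (ha x hne)
    rw [hax, neg_eq_zero]
    refine Finset.sum_eq_zero fun y hy => ?_
    rw [MonoidAlgebra.coeff_ofCoeff, Finsupp.filter_apply_neg, zero_mul]
    intro hxy
    refine hxH ?_
    simpa using H.mul_mem hxy (hf y (Finsupp.mem_support_iff.1 hy))

theorem fg_of_finiteIndex_of_le {Δ H : Subgroup Γ} [Δ.FiniteIndex] (hH : H.FG) (hle : Δ ≤ H) :
    Group.FG Δ := by
  have : Group.FG H := (Group.fg_iff_subgroup_fg H).2 hH
  have : (Δ.subgroupOf H).FiniteIndex := inferInstance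
  exact Group.fg_of_surjective (f := (Subgroup.subgroupOfEquivOfLe hle).toMonoidHom)
    (Subgroup.subgroupOfEquivOfLe hle).surjective

/-- A nonzero coefficient would repeat along an infinite coset of Δ. -/
theorem eq_zero_of_single_mul_eq {Δ : Subgroup Γ} [Infinite Δ] {u : MonoidAlgebra ℤ Γ}
    (h : ∀ δ ∈ Δ, MonoidAlgebra.single δ 1 * u = u) : u = 0 := by
  ext γ
  by_contra hne
  refine Set.infinite_range_of_injective (f := fun δ : Δ => (δ : Γ) * γ)
    (fun x y hxy => Subtype.ext (mul_left_injective γ hxy)) (u.coeff.hasFiniteSupport.subset ?_)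
  rintro _ ⟨δ, rfl⟩
  rw [Function.mem_support]
  have := congrArg (fun v : MonoidAlgebra ℤ Γ => v.coeff (δ * γ)) (h δ δ.2)
  simp only [MonoidAlgebra.coeff_single_mul_apply, inv_mul_cancel_left, one_mul] at this
  rw [← this]
  exact hne

/-- If the class of `a` in `ℤΓ / ℤΓ f` is fixed by a subgroup of finite index, then `a ∈ ℤΓ f`. -/
theorem exists_mul_eq_of_finiteIndex [Infinite Γ] (hΓ : ¬IsVirtuallyCyclic Γ)
    {f : MonoidAlgebra ℤ Γ} (hf : LinearMap.ker (rhoTilde (adjoint f)) = ⊥)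
    (a : MonoidAlgebra ℤ Γ) (Δ : Subgroup Γ) [Δ.FiniteIndex]
    (h : ∀ δ ∈ Δ, ∃ c : MonoidAlgebra ℤ Γ, c * f = MonoidAlgebra.single δ 1 * a - a) :
    ∃ e : MonoidAlgebra ℤ Γ, e * f = a := by
  classical
  set H := Subgroup.closure ((a.coeff.support ∪ f.coeff.support : Finset Γ) : Set Γ) with hH
  -- Γ need not be finitely generated, but H is. If Δ ≤ H, then Δ has finite index in H and is
  -- finitely generated too; otherwise the coset argument applies.
  by_cases hle : Δ ≤ H
  swap
  · obtain ⟨g, hgΔ, hgH⟩ := Set.not_subset.1 hle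
    obtain ⟨c, hc⟩ := h g hgΔ
    refine exists_mul_eq_of_notMem (H := H) (fun γ hγ => ?_) (fun γ hγ => ?_) hgH hc
    · exact Subgroup.subset_closure (by simp [hγ])
    · exact Subgroup.subset_closure (by simp [hγ])
  have hfg : Group.FG Δ := fg_of_finiteIndex_of_le ⟨_, rfl⟩ hle
  obtain ⟨S, hS, hSfin⟩ := Group.fg_iff.1 hfg
  have hΔ : ¬IsVirtuallyCyclic Δ := fun h => hΓ h.of_finiteIndex
  have hΔinf : Infinite Δ := by
    by_contra hfin
    rw [not_infinite_iff_finite] at hfin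
    exact not_finite_iff_infinite.2 ‹Infinite Γ› (Finite.of_subgroup_quotient Δ)
  choose! c hc using h
  have hcoc : ∀ δ ∈ Δ, ∀ ε ∈ Δ, ∀ γ,
      (c (δ * ε)).coeff γ = (c ε).coeff (δ⁻¹ * γ) + (c δ).coeff γ := by
    intro δ hδ ε hε γ
    have key : c (δ * ε) = MonoidAlgebra.single δ 1 * c ε + c δ := by
      refine mul_right_cancel_of_ker hf ?_
      rw [add_mul, mul_assoc, hc _ (Δ.mul_mem hδ hε), hc _ hδ, hc _ hε, mul_sub, ← mul_assoc,
        MonoidAlgebra.single_mul_single, one_mul]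
      abel
    rw [key]
    simp
  -- Formally b γ x = v (x γ) - v γ with v = a f⁻¹. If v vanishes at infinity, the limit β γ of b γ
  -- is -v γ, whence the sign in e below.
  let b : Γ → Δ → ℤ := fun γ x => (c (x : Γ)⁻¹).coeff γ
  have hb_mul : ∀ γ (g x : Δ), b γ (g * x) = (c (g : Γ)⁻¹).coeff (x * γ) + b γ x := by
    intro γ g x
    change (c ((g * x : Δ) : Γ)⁻¹).coeff γ = _
    rw [Subgroup.coe_mul, mul_inv_rev, hcoc _ (Δ.inv_mem x.2) _ (Δ.inv_mem g.2), inv_inv]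
  have hconst : ∀ γ, ∃ β : ℤ, {x | b γ x ≠ β}.Finite := by
    intro γ
    have hinj : Function.Injective fun x : Δ => (x : Γ) * γ :=
      fun x y hxy => Subtype.ext (mul_left_injective γ hxy)
    refine exists_finite_ne_of_energy hSfin hS hΔ (b γ) (fun g => ?_) fun T η hη => ?_
    · refine ((c (g : Γ)⁻¹).coeff.hasFiniteSupport.preimage hinj.injOn).subset fun x hx => ?_
      intro h0
      refine hx ?_
      rw [hb_mul, h0, zero_add]
    · have hinv : Function.Injective fun s : Δ => (s : Γ)⁻¹ :=
        fun x y hxy => Subtype.ext (inv_injective hxy)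
      obtain ⟨w, hw, hE⟩ := exists_approx_coboundary hf a c (T.map ⟨_, hinv⟩) (fun s hs => by
        obtain ⟨t, -, rfl⟩ := Finset.mem_map.1 hs
        exact hc _ (Δ.inv_mem t.2)) hη
      refine ⟨fun x => w (x * γ), hw.preimage hinj.injOn, fun Z => ?_⟩
      refine le_of_eq_of_le ?_ (hE (Z.map ⟨_, hinj⟩))
      rw [Finset.sum_map]
      refine Finset.sum_congr rfl fun z _ => ?_
      rw [Finset.sum_map]
      refine Finset.sum_congr rfl fun s _ => ?_
      rw [hb_mul]
      simp only [Function.Embedding.coeFn_mk, inv_inv, Int.cast_add, Subgroup.coe_mul, mul_assoc]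
      ring
  choose β hβ using hconst
  have hβ_mul : ∀ γ (δ : Δ), β (δ * γ) = β γ - b γ δ := by
    intro γ δ
    have hshift : {x : Δ | b γ (x * δ) ≠ β γ}.Finite :=
      (hβ γ).preimage (f := fun x => x * δ) (mul_left_injective δ).injOn
    obtain ⟨x, hx⟩ := ((hβ (δ * γ)).union hshift).infinite_compl.nonempty
    simp only [Set.mem_compl_iff, Set.mem_union, Set.mem_ofPred_eq, not_or, not_not] at hx
    rw [← hx.1, ← hx.2, hb_mul, add_sub_cancel_right]
  -- On a right coset Δ r, β (δ r) = β r - b r δ vanishes for all but finitely many δ. Inverting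
  -- left coset representatives gives right ones.
  have hβfin : (Function.support fun γ => -β γ).Finite := by
    let r : Γ ⧸ Δ → Γ := fun q => q.out⁻¹
    refine (Set.finite_iUnion fun q : Γ ⧸ Δ =>
      (hβ (r q)).image fun δ : Δ => (δ : Γ) * r q).subset fun γ hγ => ?_
    obtain ⟨d, hd⟩ := QuotientGroup.mk_out_eq_mul Δ γ⁻¹
    have hγr : γ = d * r (QuotientGroup.mk γ⁻¹) := by
      simp only [r, hd]
      simp
    refine Set.mem_iUnion.2 ⟨QuotientGroup.mk γ⁻¹, d, fun h0 => hγ ?_, hγr.symm⟩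
    change -β γ = 0
    rw [hγr, hβ_mul, h0, sub_self, neg_zero]
  let e : MonoidAlgebra ℤ Γ := MonoidAlgebra.ofCoeff (Finsupp.ofSupportFinite _ hβfin)
  have he : ∀ γ, e.coeff γ = -β γ := fun _ => rfl
  have hec : ∀ δ ∈ Δ, MonoidAlgebra.single δ 1 * e = c δ + e := by
    intro δ hδ
    ext γ
    have := hβ_mul γ ⟨δ⁻¹, Δ.inv_mem hδ⟩
    simp only [b, inv_inv] at this
    rw [MonoidAlgebra.coeff_single_mul_apply, MonoidAlgebra.coeff_add, Finsupp.add_apply, he, he,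
      this]
    ring
  -- Since c is the coboundary of e, the element e f - a is Δ-invariant.
  refine ⟨e, sub_eq_zero.1 (eq_zero_of_single_mul_eq (Δ := Δ) fun δ hδ => ?_)⟩
  rw [mul_sub, ← mul_assoc, hec δ hδ, add_mul, hc δ hδ]
  abel

end FiniteOrbits

/-! ### Duality between `X_f` and `ℤΓ / ℤΓ f` -/

section Duality

variable {Γ : Type*}

/-- The pairing `∑ a_γ x_γ` between `𝕋 ^ Γ` and the integral group ring. -/
def pairing (x : Γ → UnitAddCircle) : MonoidAlgebra ℤ Γ →+ UnitAddCircle :=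
  (Finsupp.liftAddHom fun γ => zmultiplesHom UnitAddCircle (x γ)).comp
    MonoidAlgebra.coeffAddEquiv.toAddMonoidHom

theorem pairing_apply (x : Γ → UnitAddCircle) (a : MonoidAlgebra ℤ Γ) :
    pairing x a = ∑ γ ∈ a.coeff.support, a.coeff γ • x γ := rfl

theorem pairing_single (x : Γ → UnitAddCircle) (γ : Γ) (n : ℤ) :
    pairing x (MonoidAlgebra.single γ n) = n • x γ := by
  change (Finsupp.liftAddHom fun γ => zmultiplesHom UnitAddCircle (x γ)) (Finsupp.single γ n) = _
  simp

theorem pairing_add (x y : Γ → UnitAddCircle) (a : MonoidAlgebra ℤ Γ) :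
    pairing (x + y) a = pairing x a + pairing y a := by
  simp [pairing_apply, Finset.sum_add_distrib]

theorem continuous_pairing (a : MonoidAlgebra ℤ Γ) :
    Continuous fun x : Γ → UnitAddCircle => pairing x a := by
  simp only [pairing_apply]
  fun_prop

variable [Group Γ]

theorem pairing_leftShift (x : Γ → UnitAddCircle) (g : Γ) (a : MonoidAlgebra ℤ Γ) :
    pairing (leftShift g x) a = pairing x (MonoidAlgebra.single g⁻¹ 1 * a) := by
  induction a using MonoidAlgebra.induction_linear with
  | zero => simp
  | add a b ha hb => rw [mul_add, map_add, map_add, ha, hb]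
  | single γ n =>
    rw [MonoidAlgebra.single_mul_single, one_mul, pairing_single, pairing_single]
    rfl

theorem mem_X_iff {f : MonoidAlgebra ℤ Γ} {x : Γ → UnitAddCircle} :
    x ∈ X f ↔ ∀ γ, pairing x (MonoidAlgebra.single γ 1 * f) = 0 := by
  have h : ∀ γ, pairing x (MonoidAlgebra.single γ 1 * f) = rho f x γ := by
    intro γ
    have := pairing_leftShift x γ⁻¹ f
    rw [inv_inv] at this
    rw [← this, pairing_apply, rho_apply]
    simp [leftShift]
  simp only [h, X, AddMonoidHom.mem_ker]
  exact funext_iff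

theorem pairing_mul_eq_zero {f : MonoidAlgebra ℤ Γ} {x : Γ → UnitAddCircle} (hx : x ∈ X f)
    (c : MonoidAlgebra ℤ Γ) : pairing x (c * f) = 0 := by
  induction c using MonoidAlgebra.induction_linear with
  | zero => simp
  | add a b ha hb => rw [add_mul, map_add, ha, hb, add_zero]
  | single γ n =>
    have : MonoidAlgebra.single γ n = n • (MonoidAlgebra.single γ 1 : MonoidAlgebra ℤ Γ) := by
      rw [MonoidAlgebra.smul_single, smul_eq_mul, mul_one]
    rw [this, smul_mul_assoc, map_zsmul, mem_X_iff.1 hx γ, smul_zero]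

/-- The embedding of `ℚ / ℤ` in `ℝ / ℤ`. -/
def ratCircle : AddCircle (1 : ℚ) →+ UnitAddCircle :=
  QuotientAddGroup.map _ _ (Rat.castHom ℝ).toAddMonoidHom (by
    rintro _ ⟨n, rfl⟩
    exact ⟨n, by simp⟩)

theorem ratCircle_injective : Function.Injective ratCircle := by
  rw [injective_iff_map_eq_zero]
  intro q hq
  obtain ⟨r, rfl⟩ := QuotientAddGroup.mk_surjective q
  obtain ⟨n, hn⟩ := (QuotientAddGroup.eq_zero_iff _).1 hq
  refine (QuotientAddGroup.eq_zero_iff _).2 ⟨n, ?_⟩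
  have hn' : (n : ℝ) = (r : ℝ) := by simpa using hn
  have : (n : ℚ) = r := by exact_mod_cast hn'
  simpa using this

/-- The annihilator of `X_f` is `ℤΓ f`. -/
theorem exists_mul_eq_of_pairing_eq_zero {f a : MonoidAlgebra ℤ Γ}
    (h : ∀ x ∈ X f, pairing x a = 0) : ∃ c : MonoidAlgebra ℤ Γ, c * f = a := by
  rw [← Ideal.mem_span_singleton']
  by_contra ha
  let I : Submodule (MonoidAlgebra ℤ Γ) (MonoidAlgebra ℤ Γ) := Ideal.span {f}
  have ha' : (Submodule.Quotient.mk a : MonoidAlgebra ℤ Γ ⧸ I) ≠ 0 := by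
    rwa [Ne, Submodule.Quotient.mk_eq_zero]
  -- ℚ/ℤ-valued characters separate points of ℤΓ / ℤΓ f. One that is nonzero at a yields, through
  -- its values on Γ, a point of X_f pairing nontrivially with a.
  obtain ⟨φ, hφ⟩ := CharacterModule.exists_character_apply_ne_zero_of_ne_zero ha'
  let φ' : (MonoidAlgebra ℤ Γ ⧸ I) →+ AddCircle (1 : ℚ) := φ
  let ψ : MonoidAlgebra ℤ Γ →+ UnitAddCircle :=
    ratCircle.comp (φ'.comp I.mkQ.toAddMonoidHom)
  have hψ : pairing (fun γ => ψ (MonoidAlgebra.single γ 1)) = ψ := by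
    refine MonoidAlgebra.addMonoidHom_ext fun γ n => ?_
    rw [pairing_single, ← map_zsmul, MonoidAlgebra.smul_single, smul_eq_mul, mul_one]
  have hψI : ∀ u ∈ I, ψ u = 0 := by
    intro u hu
    have : I.mkQ u = 0 := (Submodule.Quotient.mk_eq_zero I).2 hu
    change ratCircle (φ' (I.mkQ u)) = 0
    rw [this, map_zero, map_zero]
  refine hφ (ratCircle_injective ?_)
  rw [map_zero]
  refine Eq.trans ?_ (h (fun γ => ψ (MonoidAlgebra.single γ 1)) ?_)
  · rw [hψ]; rfl
  · rw [mem_X_iff]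
    intro γ
    rw [hψ]
    exact hψI _ (Ideal.mul_mem_left _ _ (Ideal.subset_span rfl))

end Duality

/-! ### Characters of `X_f` -/

section Characters

open BoundedContinuousFunction

variable {Γ : Type*} [Group Γ] {f : MonoidAlgebra ℤ Γ}

/-- The character `x ↦ exp (2 π i ∑ a_γ x_γ)` of `X_f`. -/
def character (f a : MonoidAlgebra ℤ Γ) : X f →ᵇ ℂ :=
  BoundedContinuousFunction.mkOfCompact
    ⟨fun x => (AddCircle.toCircle (pairing x.1 a) : ℂ), continuous_subtype_val.comp
      (AddCircle.continuous_toCircle.comp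
        ((continuous_pairing a).comp continuous_subtype_val))⟩

theorem character_apply (a : MonoidAlgebra ℤ Γ) (x : X f) :
    character f a x = (AddCircle.toCircle (pairing x.1 a) : ℂ) := rfl

theorem character_zero : character f 0 = 1 := by
  ext x
  simp [character_apply]

theorem character_add (a b : MonoidAlgebra ℤ Γ) :
    character f (a + b) = character f a * character f b := by
  ext x
  simp [character_apply, AddCircle.toCircle_add]

theorem star_character (a : MonoidAlgebra ℤ Γ) : star (character f a) = character f (-a) := by
  ext x
  rw [character_apply, map_neg, AddCircle.toCircle_neg, Circle.coe_inv_eq_conj]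
  rfl

theorem character_smul (a : MonoidAlgebra ℤ Γ) (g : Γ) (x : X f) :
    character f a (g • x) = character f (MonoidAlgebra.single g⁻¹ 1 * a) x := by
  rw [character_apply, character_apply, ← pairing_leftShift]
  rfl

theorem character_add_apply (a : MonoidAlgebra ℤ Γ) (x y : X f) :
    character f a (x + y) = character f a x * character f a y := by
  simp [character_apply, pairing_add, AddCircle.toCircle_add]

theorem character_eq_iff {a b : MonoidAlgebra ℤ Γ} :
    character f a = character f b ↔ ∃ c : MonoidAlgebra ℤ Γ, c * f = a - b := by
  constructor
  · intro h
    refine exists_mul_eq_of_pairing_eq_zero fun x hx => ?_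
    have := congrArg (fun u : X f →ᵇ ℂ => u ⟨x, hx⟩) h
    simp only [character_apply] at this
    rw [map_sub, sub_eq_zero]
    exact AddCircle.injective_toCircle one_ne_zero (Subtype.ext this)
  · rintro ⟨c, hc⟩
    ext x
    have h := pairing_mul_eq_zero x.2 c
    rw [hc, map_sub, sub_eq_zero] at h
    rw [character_apply, character_apply, h]

/-- The `Γ`-orbit of a nontrivial character of `X_f` is infinite. -/
theorem infinite_orbit_character [Infinite Γ] (hΓ : ¬IsVirtuallyCyclic Γ)
    (hf : LinearMap.ker (rhoTilde (adjoint f)) = ⊥) {a : MonoidAlgebra ℤ Γ}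
    (ha : character f a ≠ 1) :
    (Set.range fun g : Γ => character f (MonoidAlgebra.single g 1 * a)).Infinite := by
  intro hfin
  have hmul : ∀ (g : Γ) (b b' : MonoidAlgebra ℤ Γ), character f b = character f b' →
      character f (MonoidAlgebra.single g 1 * b) = character f (MonoidAlgebra.single g 1 * b') := by
    intro g b b' h
    ext x
    rw [← inv_inv g, ← character_smul, ← character_smul, h]
  have hmul' : ∀ g h : Γ, MonoidAlgebra.single (g * h) 1 * a =
      MonoidAlgebra.single g 1 * (MonoidAlgebra.single h 1 * a) := by
    intro g h
    rw [← mul_assoc, MonoidAlgebra.single_mul_single, one_mul]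
  let Δ : Subgroup Γ :=
    { carrier := {g | character f (MonoidAlgebra.single g 1 * a) = character f a}
      one_mem' := by
        change character f (MonoidAlgebra.single 1 1 * a) = _
        rw [← MonoidAlgebra.one_def, one_mul]
      mul_mem' := fun {g h} hg hh => by
        change character f (MonoidAlgebra.single (g * h) 1 * a) = _
        rw [hmul', hmul g _ _ hh]
        exact hg
      inv_mem' := fun {g} hg => by
        change character f (MonoidAlgebra.single g⁻¹ 1 * a) = _
        rw [← hmul g⁻¹ _ _ hg, ← hmul', inv_mul_cancel, ← MonoidAlgebra.one_def, one_mul] }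
  have hquot : Finite (Γ ⧸ Δ) := by
    have : Finite (Set.range fun g : Γ => character f (MonoidAlgebra.single g 1 * a)) := hfin
    refine Finite.of_injective (β := Set.range fun g : Γ =>
      character f (MonoidAlgebra.single g 1 * a)) (fun q => ⟨_, q.out, rfl⟩) fun q q' hqq => ?_
    rw [← QuotientGroup.out_eq' q, ← QuotientGroup.out_eq' q', QuotientGroup.eq]
    change character f (MonoidAlgebra.single (q.out⁻¹ * q'.out) 1 * a) = _
    rw [hmul', ← hmul _ _ _ (Subtype.ext_iff.1 hqq), ← hmul', inv_mul_cancel,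
      ← MonoidAlgebra.one_def, one_mul]
  have : Δ.FiniteIndex := Subgroup.finiteIndex_of_finite_quotient
  obtain ⟨e, he⟩ := exists_mul_eq_of_finiteIndex hΓ hf a Δ fun δ hδ => character_eq_iff.1 hδ
  refine ha ?_
  rw [← character_zero, character_eq_iff]
  exact ⟨e, by rw [he, sub_zero]⟩

/-! ### Fourier analysis for the Haar measure of X_f. -/

variable [Countable Γ]

instance polishSpace_X (f : MonoidAlgebra ℤ Γ) : PolishSpace (X f) :=
  (isCompact_iff_compactSpace.2 (X_compactSpace f)).isClosed.polishSpace

/-- Translating by y multiplies the integral by the value of the character at y, which differs from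
1 for some y. -/
theorem integral_character (f : MonoidAlgebra ℤ Γ) {a : MonoidAlgebra ℤ Γ}
    (ha : character f a ≠ 1) : ∫ x, character f a x ∂haar f = 0 := by
  obtain ⟨y, hy⟩ : ∃ y, character f a y ≠ 1 := by
    by_contra! h
    exact ha (BoundedContinuousFunction.ext h)
  have h := integral_add_left_eq_self (μ := haar f) (fun x => character f a x) y
  simp only [character_add_apply, integral_const_mul] at h
  by_contra hne
  exact hy (mul_right_cancel₀ hne (by rw [h, one_mul]))

theorem orthonormal_character (f : MonoidAlgebra ℤ Γ) {ι : Type*} (a : ι → MonoidAlgebra ℤ Γ)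
    (ha : Function.Injective fun i => character f (a i)) :
    Orthonormal ℂ fun i => BoundedContinuousFunction.toLp 2 (haar f) ℂ (character f (a i)) := by
  classical
  rw [orthonormal_iff_ite]
  intro i j
  rw [BoundedContinuousFunction.inner_toLp]
  have hprod : ∀ x, character f (a j) x * (starRingEnd ℂ) (character f (a i) x) =
      character f (a j - a i) x := by
    intro x
    rw [sub_eq_add_neg, character_add, ← star_character]
    rfl
  simp only [hprod]
  split_ifs with hij
  · simp [hij, character_zero]
  · refine integral_character f fun h => hij (ha ?_)
    rw [← character_zero, character_eq_iff, sub_zero] at h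
    exact (character_eq_iff.2 h).symm

/-- If infinitely many different characters have the same integral over a set, then this integral
vanishes. -/
theorem setIntegral_character_eq_zero (f : MonoidAlgebra ℤ Γ) {ι : Type*} [Infinite ι]
    (a : ι → MonoidAlgebra ℤ Γ) (ha : Function.Injective fun i => character f (a i))
    {E : Set (X f)} (hE : MeasurableSet E) {κ : ℂ}
    (hκ : ∀ i, ∫ x in E, character f (a i) x ∂haar f = κ) : κ = 0 := by
  have horth := orthonormal_character f a ha
  have hinner : ∀ i, ‖inner ℂ (BoundedContinuousFunction.toLp 2 (haar f) ℂ (character f (a i)))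
      (indicatorConstLp 2 hE (measure_ne_top (haar f) E) (1 : ℂ))‖ = ‖κ‖ := by
    intro i
    rw [norm_inner_symm, L2.inner_indicatorConstLp_one, ← hκ i]
    refine congrArg _ (integral_congr_ae (ae_restrict_of_ae ?_))
    exact BoundedContinuousFunction.coeFn_toLp 2 (haar f) ℂ _
  by_contra hne
  have hpos : 0 < ‖κ‖ ^ 2 := by positivity
  set C := ‖indicatorConstLp 2 hE (measure_ne_top (haar f) E) (1 : ℂ)‖ ^ 2 with hC
  -- Bessel's inequality for n of the characters gives n ‖κ‖² ≤ C.
  obtain ⟨n, hn⟩ := exists_nat_gt (C / ‖κ‖ ^ 2)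
  obtain ⟨s, hs⟩ := Infinite.exists_subset_card_eq ι n
  have := horth.sum_inner_products_le (s := s)
    (indicatorConstLp 2 hE (measure_ne_top (haar f) E) (1 : ℂ))
  simp only [hinner, Finset.sum_const, hs, nsmul_eq_mul] at this
  rw [div_lt_iff₀ hpos] at hn
  exact absurd this (not_le.2 hn)

/-- Finite measures on `X_f` with the same Fourier coefficients are equal. -/
theorem measure_eq_of_integral_character (f : MonoidAlgebra ℤ Γ) {P Q : Measure (X f)}
    [IsFiniteMeasure P] [IsFiniteMeasure Q]
    (h : ∀ a, ∫ x, character f a x ∂P = ∫ x, character f a x ∂Q) : P = Q := by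
  let A : StarSubalgebra ℂ (X f →ᵇ ℂ) := StarAlgebra.adjoin ℂ (Set.range (character f))
  refine ext_of_forall_mem_subalgebra_integral_eq_of_polish (𝕜 := ℂ) (A := A) ?_ ?_
  · intro x y hxy
    obtain ⟨γ, hγ⟩ : ∃ γ, x.1 γ ≠ y.1 γ := by
      by_contra! h
      exact hxy (Subtype.ext (funext h))
    refine ⟨_, ⟨_, ⟨character f (MonoidAlgebra.single γ 1),
      StarAlgebra.subset_adjoin ℂ _ ⟨_, rfl⟩, rfl⟩, rfl⟩, fun hxy' => hγ ?_⟩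
    have h1 : (AddCircle.toCircle (pairing x.1 (MonoidAlgebra.single γ 1)) : ℂ) =
      AddCircle.toCircle (pairing y.1 (MonoidAlgebra.single γ 1)) := hxy'
    have h2 := AddCircle.injective_toCircle one_ne_zero (Subtype.ext h1)
    simpa [pairing_single] using h2
  -- Characters are closed under products and conjugation, so the star algebra they generate is
  -- their linear span.
  · have hstar : star (Set.range (character f)) ⊆ Set.range (character f) := by
      rintro u ⟨a, ha⟩
      refine ⟨-a, ?_⟩
      rw [← star_character, ha, star_star]
    have hclosure : (Submonoid.closure (Set.range (character f)) : Set (X f →ᵇ ℂ)) =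
        Set.range (character f) := by
      let M : Submonoid (X f →ᵇ ℂ) :=
        { carrier := Set.range (character f)
          one_mem' := ⟨0, character_zero⟩
          mul_mem' := by
            rintro _ _ ⟨a, rfl⟩ ⟨b, rfl⟩
            exact ⟨a + b, character_add a b⟩ }
      exact congrArg SetLike.coe (Submonoid.closure_eq M)
    intro g hg
    have hg' : g ∈ Submodule.span ℂ (Set.range (character f)) := by
      have h1 : g ∈ A.toSubalgebra := hg
      rw [StarAlgebra.adjoin_toSubalgebra, Set.union_eq_self_of_subset_right hstar,
        ← Subalgebra.mem_toSubmodule, Algebra.adjoin_eq_span, hclosure] at h1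
      exact h1
    clear hg
    induction hg' using Submodule.span_induction with
    | mem u hu =>
      obtain ⟨a, rfl⟩ := hu
      exact h a
    | zero => simp
    | add u v _ _ ihu ihv =>
      simp only [BoundedContinuousFunction.coe_add, Pi.add_apply]
      rw [integral_add (u.integrable P) (v.integrable P),
        integral_add (u.integrable Q) (v.integrable Q), ihu, ihv]
    | smul r u _ ihu =>
      simp only [BoundedContinuousFunction.coe_smul]
      rw [integral_smul, integral_smul, ihu]

/-- Each g acts by a topological automorphism, and the normalized Haar measure is unique. -/
theorem smulInvariantMeasure_haar (f : MonoidAlgebra ℤ Γ) :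
    SMulInvariantMeasure Γ (X f) (haar f) := by
  refine ⟨fun g s hs => ?_⟩
  have hcont : ∀ h : Γ, Continuous fun x : X f => h • x := fun h => continuous_const_smul h
  have := AddEquiv.isAddHaarMeasure_map (haar f) (DistribMulAction.toAddEquiv (X f) g)
    (hcont g) (hcont g⁻¹)
  have hprob : IsProbabilityMeasure
      (Measure.map (DistribMulAction.toAddEquiv (X f) g) (haar f)) :=
    Measure.isProbabilityMeasure_map (hcont g).measurable.aemeasurable
  have heq := Measure.isAddHaarMeasure_eq_of_isProbabilityMeasure
    (Measure.map (DistribMulAction.toAddEquiv (X f) g) (haar f)) (haar f)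
  conv_rhs => rw [← heq]
  exact (Measure.map_apply (hcont g).measurable hs).symm

end Characters

/-- If `f` acts injectively on `ℓ²(Γ, ℝ)` by right multiplication and `Γ` is not virtually cyclic,
then the principal algebraic action `α_f` is ergodic. -/
theorem ergodicSMul_haar {Γ : Type*} [Group Γ] [Countable Γ] [Infinite Γ]
    (hΓ : ¬IsVirtuallyCyclic Γ) (f : MonoidAlgebra ℤ Γ)
    (hf : LinearMap.ker (rhoTilde (adjoint f)) = ⊥) : ErgodicSMul Γ (X f) (haar f) := by
  have hinv := smulInvariantMeasure_haar f
  refine ⟨fun {E} hE hEinv => ?_⟩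
  have hcoeff : ∀ a, character f a ≠ 1 → ∫ x in E, character f a x ∂haar f = 0 := by
    intro a ha
    have hinf := (infinite_orbit_character hΓ hf ha).to_subtype
    choose g hg using fun u : Set.range fun g : Γ =>
      character f (MonoidAlgebra.single g 1 * a) => u.2
    simp only at hg
    refine setIntegral_character_eq_zero f (fun u => MonoidAlgebra.single (g u) 1 * a)
      (fun u v huv => ?_) hE fun u => ?_
    · simp only [hg] at huv
      exact Subtype.ext huv
    · have hmp := measurePreserving_smul (g u)⁻¹ (haar f)
      have hemb : MeasurableEmbedding fun x : X f => (g u)⁻¹ • x :=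
        (Homeomorph.smul (g u)⁻¹).measurableEmbedding
      have h := hmp.setIntegral_preimage_emb hemb (fun x => character f a x) E
      rw [setIntegral_congr_set (hEinv (g u)⁻¹)] at h
      simpa only [character_smul, inv_inv] using h
  have hmeas : (haar f).restrict E = haar f E • haar f := by
    have : IsFiniteMeasure (haar f E • haar f) :=
      (haar f).smul_finite (measure_ne_top (haar f) E)
    refine measure_eq_of_integral_character f fun a => ?_
    rw [integral_smul_measure]
    by_cases ha : character f a = 1
    · simp [ha, Measure.real]
    · rw [hcoeff a ha, integral_character f ha, smul_zero]
  -- Evaluated on Eᶜ, the identity says that the measures of E and Eᶜ have product 0.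
  have hprod := congrArg (fun ν => ν Eᶜ) hmeas
  simp only [Measure.restrict_apply hE.compl, Set.compl_inter_self, measure_empty,
    Measure.smul_apply, smul_eq_mul] at hprod
  rw [Filter.eventuallyConst_set]
  rcases mul_eq_zero.1 hprod.symm with h | h
  · exact Or.inr (measure_eq_zero_iff_ae_notMem.1 h)
  · exact Or.inl (by simpa using measure_eq_zero_iff_ae_notMem.1 h)

end PrincipalAction

end

theorem theorem1p3 (Γ : Type*) [Group Γ] [Countable Γ] [Infinite Γ]
    (hΓ : ¬ PrincipalAction.IsVirtuallyCyclic Γ) (f : MonoidAlgebra ℤ Γ)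
    (hf : LinearMap.ker (PrincipalAction.rhoTilde (PrincipalAction.adjoint f)) = ⊥) :
    ErgodicSMul Γ (PrincipalAction.X f) (PrincipalAction.haar f) :=
  PrincipalAction.ergodicSMul_haar hΓ f hf
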